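/- Let $n\ge 1$, let $M=(M_1,\dots,M_n)\in\mathbb N^n$, $a=(a_1,\dots,a_n)\in\mathbb C^n$, and let $A_1,\dots,A_n$ be holomorphic functions near $0\in\mathbb C^n$ with $A_i(0)=0$. Let $f$ be the germ of biholomorphism at $0\in\mathbb C^n$ with components $$f_i(\mathbf x)=x_i\bigl(1+\mathbf x^M(a_i+A_i(\mathbf x))\bigr),\qquad \mathbf x^M=x_1^{M_1}\cdots x_n^{M_n}.$$ Write $\langle a,I\rangle=\sum_i a_iI_i$, $d=\gcd(M_1,\dots,M_n)$, $m=M/d$ and $\bar m=\#\{i: m_i=0\}$. Assume $\langle a,M\rangle=-1$, $\operatorname{Re}a_i<0$ for all $i$, and that $m_i=0$ if and only if $i\ge n-\bar m+1$. Fix $\gamma>0$ with $\operatorname{Re}a_i+\gamma/d<0$ for all $i$, an index $\ell\in\{0,\dots,d-1\}$, and an $n\times n$ matrix $\mathcal M$ with entries in $\mathbb N$ and determinant $\pm1$, with first row $m$ and of the form $\mathcal M=\begin{pmatrix}\tilde M&0\\0&I_{\bar m}\end{pmatrix}$. Let $\mathcal M_i$ be the $i$-th row of $\mathcal M$ and let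 $\mathcal N=\mathcal M^{-1}$. For $\epsilon,r>0$ and $\theta\in(0,\pi/2)$ put $$U_\ell=\Bigl\{\mathbf x\in\mathbb C^n:\ |\mathbf x^m|^d<\epsilon,\ \bigl|\arg(e^{2\pi i\ell/d}\,\mathbf x^m)\bigr|<\tfrac{\theta}{d},\ |x_i|<|\mathbf x^m|^\gamma\ \forall i\Bigr\},$$ $$V=\Bigl\{(z,\mathbf w)\in\mathbb C\times\mathbb C^{n-1}:\ |z|>\epsilon^{-1},\ |\arg z|<\theta,\ |\mathbf w^{\mathcal N_i}|<r|z|^{-\gamma/d-\operatorname{Re}a_i}\ \forall i\Bigr\},$$ where $\mathbf w=(w_2,\dots,w_n)$ and $\mathbf w^{\mathcal N_i}=\prod_{j=2}^n w_j^{\mathcal N_{i,j}}$; the points of $V$ are required to satisfy $w_j\ne0$ for $2\le j\le n-\bar m$. For $\mathbf x\in U_\ell$ and $2\le i\le n$ let $$g_i(\mathbf x)=\mathbf x^{\mathcal M_i}(\mathbf x^m)^{d\langle a,\mathcal M_i\rangle},\qquad \psi_i(\mathbf x)=\lim_{j\to\infty}g_i(f^{\circ j}(\mathbf x)),\qquad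 \Phi_\ell(\mathbf x)=\bigl(1/\mathbf x^M,\psi_2(\mathbf x),\dots,\psi_n(\mathbf x)\bigr),$$ where the complex power is taken with the branch of $\log(\mathbf x^m)$ on $U_\ell$ whose imaginary part is within $\theta/d$ of $-2\pi\ell/d$. Let $T_j(z,\mathbf w)=(z-j,\mathbf w)$. Then there is $\theta_0\in(0,\pi/2)$ such that for every $\theta\in(0,\theta_0)$ there are $\epsilon_0,r_0>0$ such that for all $\epsilon\in(0,\epsilon_0)$ and $r\in(0,r_0)$ the following hold. 1. $f(U_\ell)\subset U_\ell$, the limits defining $\psi_2,\dots,\psi_n$ exist on $U_\ell$, every point of $V$ has exactly one preimage under $\Phi_\ell$ in $U_\ell$, and $\tilde F=\Phi_\ell\circ f\circ\Phi_\ell^{-1}$ is a well-defined map $V\to V$ of the form $\tilde F(z,\mathbf w)=(\tilde f(z,\mathbf w),\mathbf w)$. 2. There exist an open set $W\subset\mathbb C^n$ and a biholomorphism $\boldsymbol B:V\to W$ such that $$\boldsymbol B(\tilde F(z,\mathbf w))=\boldsymbol B(z,\mathbf w)+(1,0,\dots,0)\quad\text{for all }(z,\mathbf w)\in V$$ and $$\bigcup_{j\in\mathbb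 N}T_j(W)=\mathbb C\times(\mathbb C^*)^{n-\bar m-1}\times\mathbb C^{\bar m}.$$ -/

import Mathlib

noncomputable section

namespace FatouCoord

/-- The monomial `x ^ I = x_1 ^ I_1 ⋯ x_n ^ I_n`, for `I ∈ ℕ ^ n`. -/
def monom {n : ℕ} (x : Fin n → ℂ) (I : Fin n → ℕ) : ℂ := ∏ i, x i ^ I i

/-- `d = gcd (M_1, …, M_n)`. -/
def gcdM {n : ℕ} (M : Fin n → ℕ) : ℕ := Finset.univ.gcd M

/-- The reduced exponent `m = M / d`. -/
def redM {n : ℕ} (M : Fin n → ℕ) : Fin n → ℕ := fun i => M i / gcdM M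

/-- The number of indices `i` with `m_i = 0`. -/
def mbar {n : ℕ} (M : Fin n → ℕ) : ℕ := (Finset.univ.filter fun i => redM M i = 0).card

/-- The bilinear pairing `⟨a, I⟩ = ∑ a_i I_i`. -/
def pairing {n : ℕ} (a : Fin n → ℂ) (I : Fin n → ℕ) : ℂ := ∑ i, a i * (I i : ℂ)

/-- The map `f` with components `f_i (x) = x_i (1 + x ^ M (a_i + A_i (x)))`. Here each `A_i` is a
total function of which only the germ at the origin matters. -/
def germMap {n : ℕ} (M : Fin n → ℕ) (a : Fin n → ℂ) (A : Fin n → (Fin n → ℂ) → ℂ)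
    (x : Fin n → ℂ) : Fin n → ℂ :=
  fun i => x i * (1 + monom x M * (a i + A i x))

/-- The rotation `e ^ (2 π i ℓ / d)`. -/
def rot (d ℓ : ℕ) : ℂ := Complex.exp (2 * Real.pi * Complex.I * ℓ / d)

/-- The component `U_ℓ` of
`U = {x : |x ^ M| < ε, |arg (x ^ M)| < θ, |x_i| < |x ^ m| ^ γ for all i}`: the points of `U`
at which the argument of `x ^ m` is within `θ / d` of `- 2 π ℓ / d` (modulo `2 π`). -/
def domU {n : ℕ} (M : Fin n → ℕ) (γ ε θ : ℝ) (ℓ : ℕ) : Set (Fin n → ℂ) :=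
  {x | ‖monom x (redM M) ^ gcdM M‖ < ε ∧
    |Complex.arg (monom x (redM M) * rot (gcdM M) ℓ)| < θ / gcdM M ∧
    ∀ i, ‖x i‖ < ‖monom x (redM M)‖ ^ γ}

/-- The branch of the logarithm used on `U_ℓ`: the one whose imaginary part is close to
`- 2 π ℓ / d` at numbers whose argument is close to `- 2 π ℓ / d`. -/
def logBranch (d ℓ : ℕ) (y : ℂ) : ℂ :=
  Complex.log (y * rot d ℓ) - 2 * Real.pi * Complex.I * ℓ / d

/-- `g_I (x) = x ^ I (x ^ m) ^ λ_I` with `λ_I = d ⟨a, I⟩`. -/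
def firstIntegral {n : ℕ} (M : Fin n → ℕ) (a : Fin n → ℂ) (ℓ : ℕ) (I : Fin n → ℕ)
    (x : Fin n → ℂ) : ℂ :=
  monom x I *
    Complex.exp ((gcdM M : ℂ) * pairing a I * logBranch (gcdM M) ℓ (monom x (redM M)))

/-- `ψ_I (x) = lim_j g_I (f ^ j (x))`. -/
def psi {n : ℕ} (M : Fin n → ℕ) (a : Fin n → ℂ) (A : Fin n → (Fin n → ℂ) → ℂ) (ℓ : ℕ)
    (I : Fin n → ℕ) (x : Fin n → ℂ) : ℂ :=
  Filter.limUnder Filter.atTop fun j : ℕ => firstIntegral M a ℓ I ((germMap M a A)^[j] x)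

/-- `Φ_ℓ (x) = (1 / x ^ M, ψ_2 (x), …, ψ_n (x))`, where `ψ_i` belongs to the `i`-th row of the
matrix `P`. The first coordinate has index `0`. -/
def Phi {n : ℕ} [NeZero n] (M : Fin n → ℕ) (a : Fin n → ℂ) (A : Fin n → (Fin n → ℂ) → ℂ)
    (P : Matrix (Fin n) (Fin n) ℕ) (ℓ : ℕ) (x : Fin n → ℂ) : Fin n → ℂ :=
  fun i => if i = 0 then 1 / monom x M else psi M a A ℓ (P i) x

/-- The inverse, over the integers, of a matrix with entries in `ℕ`. -/
def invZ {n : ℕ} (P : Matrix (Fin n) (Fin n) ℕ) : Matrix (Fin n) (Fin n) ℤ :=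
  (P.map (fun k : ℕ => (k : ℤ)))⁻¹

/-- The set `ℂ × (ℂ ^ *) ^ (n - m̄ - 1) × ℂ ^ m̄` in `ℂ ^ n`. -/
def modelSpace {n : ℕ} (M : Fin n → ℕ) : Set (Fin n → ℂ) :=
  {y | ∀ j : Fin n, 1 ≤ (j : ℕ) → (j : ℕ) < n - mbar M → y j ≠ 0}

/-- `V = {(z, w) : |z| > 1 / ε, |arg z| < θ, |w ^ (N_i)| < r |z| ^ (- γ / d - Re a_i) for all i}`,
with `z = y 0`, `w = (y j)_{j ≠ 0}` and `N` the inverse of `P`. That `y` lies in `modelSpace M`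
makes explicit that the powers of `w` with negative exponents have to be defined. -/
def domV {n : ℕ} [NeZero n] (M : Fin n → ℕ) (a : Fin n → ℂ) (P : Matrix (Fin n) (Fin n) ℕ)
    (γ ε θ r : ℝ) : Set (Fin n → ℂ) :=
  {y | y ∈ modelSpace M ∧ ε⁻¹ < ‖y 0‖ ∧ |Complex.arg (y 0)| < θ ∧
    ∀ i, ‖∏ j ∈ Finset.univ.erase 0, y j ^ invZ P i j‖
      < r * ‖y 0‖ ^ (-(γ / gcdM M) - (a i).re)}

/-- `F̃ = Φ_ℓ ∘ f ∘ Φ_ℓ⁻¹`, where `Φ_ℓ⁻¹` takes its values in `U_ℓ`. -/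
def tildeF {n : ℕ} [NeZero n] (M : Fin n → ℕ) (a : Fin n → ℂ) (A : Fin n → (Fin n → ℂ) → ℂ)
    (P : Matrix (Fin n) (Fin n) ℕ) (γ ε θ : ℝ) (ℓ : ℕ) (y : Fin n → ℂ) : Fin n → ℂ :=
  Phi M a A P ℓ (germMap M a A (Function.invFunOn (Phi M a A P ℓ) (domU M γ ε θ ℓ) y))

/-- The map `(z, w) ↦ (z + c, w)`. -/
def shift {n : ℕ} [NeZero n] (c : ℂ) (y : Fin n → ℂ) : Fin n → ℂ :=
  Function.update y 0 (y 0 + c)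

/-- The translation `T_j (z_1, …, z_n) = (z_1 - j, z_2, …, z_n)`. -/
def transT {n : ℕ} [NeZero n] (j : ℕ) : (Fin n → ℂ) → (Fin n → ℂ) := shift (-(j : ℂ))

/-- `B` restricts to a biholomorphism from the open set `V` onto the open set `W`. -/
def IsBiholomorphism {n : ℕ} (B : (Fin n → ℂ) → (Fin n → ℂ)) (V W : Set (Fin n → ℂ)) : Prop :=
  IsOpen V ∧ IsOpen W ∧ DifferentiableOn ℂ B V ∧ Set.MapsTo B V W ∧
    ∃ C : (Fin n → ℂ) → (Fin n → ℂ),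
      DifferentiableOn ℂ C W ∧ Set.MapsTo C W V ∧ Set.InvOn C B V W

end FatouCoord

end

/-! On U_ℓ the function Z = 1 / x^M plays the role of time. Since ⟨a, M⟩ = -1, one has Z ∘ f = Z + 1
+ h with h holomorphic at 0 and h(0) = 0. Put q = γ / d. The bounds |x_i| < |Z|^(-q) make every
holomorphic germ vanishing at 0 of size O(|Z|^(-q)) on U_ℓ. Because Re a_i + q < 0, they persist
under f once the sector is narrow and |Z| is large. So U_ℓ is invariant and Re Z grows by at least
1/2 at each step (`exists_inv`).

The leading first integral x^I Z^(-⟨a, I⟩) is multiplied at each step by exp(O(|Z|^(-1-q))), so it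
converges along orbits. Its limit ψ_I is the leading integral evaluated at the corrected point with
coordinates x_i exp(H_i(x)), where H_i is a small sum over the orbit. As the matrix is unimodular,
the leading integrals are inverted by explicit monomials X(y). The true preimage is X_i(y)
exp(-η_i), where η is the fixed point of a contraction (`norm_T_sub_le`), and it depends
holomorphically on y. This gives Φ_ℓ⁻¹ = `S` on V (`Ph_S`, `eq_S_of_Ph_eq`).

It remains to solve the Abel equation b ∘ f = b + 1 with b close to Z. Summing h along orbits need
not converge, since h is only O(|Z|^(-q)). So Z is first replaced by Z + Z u, with u a polynomial in
x and log Z chosen order by order in x (`exists_Dz_gen`). A resonance 1 + ⟨a, I⟩ = 0 costs one more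
power of log Z. When the remaining error is O(|Z|^(-3/2)), its sum along orbits completes b
(`exists_abel`), and b = Z + O(|Z|^(1-δ)).

Finally B(z, w) = (b(S(z, w)), w). Cauchy estimates in z, on discs of radius comparable to |z|
inside a larger domain, make b ∘ S - z a contraction in z (`Fine.dev_sub_le`). This gives
injectivity and invertible derivatives. Every point of the model space, translated far enough, has a
preimage by a fixed point argument (`Fine.exists_fatou_eq`). -/

noncomputable section

namespace FatouCoord

open Filter Topology Metric

/-! ### Cauchy estimates and series of holomorphic maps -/

section Holomorphic

variable {E F : Type*} [NormedAddCommGroup E] [NormedSpace ℂ E]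
  [NormedAddCommGroup F] [NormedSpace ℂ F]

/-- Cauchy estimate for the derivative of a bounded holomorphic map. -/
theorem norm_fderiv_le_of_bound {f : E → F} {c : E} {ρ K : ℝ} (hρ : 0 < ρ)
    (hd : DifferentiableOn ℂ f (ball c ρ)) (hK : ∀ x ∈ ball c ρ, ‖f x‖ ≤ K) :
    ‖fderiv ℂ f c‖ ≤ 2 * K / ρ := by
  refine Complex.norm_fderiv_le_div_of_mapsTo_ball hd (fun x hx => ?_) hρ
  have h1 := hK x hx
  have h2 := hK c (mem_ball_self hρ)
  rw [mem_closedBall, dist_eq_norm]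
  linarith [norm_sub_le (f x) (f c)]

/-- A bounded holomorphic map is Lipschitz at the centre of a ball. -/
theorem dist_le_of_bound {f : E → F} {c z : E} {ρ K : ℝ}
    (hd : DifferentiableOn ℂ f (ball c ρ)) (hK : ∀ x ∈ ball c ρ, ‖f x‖ ≤ K)
    (hz : z ∈ ball c ρ) : ‖f z - f c‖ ≤ 2 * K / ρ * ‖z - c‖ := by
  have hρ : 0 < ρ := dist_nonneg.trans_lt hz
  have := Complex.dist_le_div_mul_dist_of_mapsTo_ball (R₂ := 2 * K) hd (fun x hx => ?_) hz
  · simpa [dist_eq_norm] using this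
  have h1 := hK x hx
  have h2 := hK c (mem_ball_self hρ)
  rw [mem_closedBall, dist_eq_norm]
  linarith [norm_sub_le (f x) (f c)]

/-- A normally convergent series of holomorphic maps is holomorphic. -/
theorem differentiableOn_tsum_of_bound [CompleteSpace F] {U : Set E} (hU : IsOpen U)
    {g : ℕ → E → F} {u : ℕ → ℝ} (hu : Summable u)
    (hg : ∀ k, DifferentiableOn ℂ (g k) U) (hb : ∀ k, ∀ x ∈ U, ‖g k x‖ ≤ u k) :
    DifferentiableOn ℂ (fun x => ∑' k, g k x) U := by
  intro x hx
  obtain ⟨ρ, hρ, hball⟩ := Metric.isOpen_iff.1 hU x hx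
  let _ : NormedSpace ℝ E := NormedSpace.restrictScalars ℝ ℂ E
  have hsub : ∀ y ∈ ball x (ρ / 2), ball y (ρ / 2) ⊆ U := fun y hy =>
    (ball_subset_ball' (by rw [mem_ball] at hy; linarith)).trans hball
  have hx' : x ∈ ball x (ρ / 2) := mem_ball_self (by linarith)
  -- Cauchy's estimate on balls of radius ρ / 2 turns the bounds `u k` into summable bounds for the
  -- derivatives on the half ball.
  have := hasFDerivAt_tsum_of_isPreconnected (𝕜 := ℂ) (f := g) (f' := fun k y => fderiv ℂ (g k) y)
    (u := fun k => 2 * u k / (ρ / 2)) (x₀ := x) (x := x) (s := ball x (ρ / 2))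
    ((hu.mul_left 2).div_const _) isOpen_ball
    (convex_ball x (ρ / 2)).isPreconnected
    (fun k y hy => ((hg k).differentiableAt
      (hU.mem_nhds (hsub y hy (mem_ball_self (by linarith))))).hasFDerivAt)
    (fun k y hy => norm_fderiv_le_of_bound (by linarith) ((hg k).mono (hsub y hy))
      (fun z hz => hb k z (hsub y hy hz)))
    hx' (Summable.of_norm_bounded hu (fun k => hb k x hx)) hx'
  exact this.differentiableAt.differentiableWithinAt

/-- A holomorphic map is strictly differentiable. -/
theorem hasStrictFDerivAt_of_differentiableOn {f : E → F} {U : Set E} (hU : IsOpen U)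
    (hf : DifferentiableOn ℂ f U) {x : E} (hx : x ∈ U) :
    HasStrictFDerivAt f (fderiv ℂ f x) x := by
  have hfx : HasFDerivAt f (fderiv ℂ f x) x :=
    (hf.differentiableAt (hU.mem_nhds hx)).hasFDerivAt
  refine HasStrictFDerivAt.of_isLittleO ?_
  rw [Asymptotics.isLittleO_iff]
  intro c hc
  have h1 := (Asymptotics.isLittleO_iff.1 hfx.isLittleO) (c := c / 8) (by positivity)
  obtain ⟨ρ, hρ, hball⟩ := Metric.eventually_nhds_iff_ball.1 (h1.and (hU.mem_nhds hx))
  have hnear : ∀ᶠ q : E × E in 𝓝 (x, x), q.1 ∈ ball x (ρ / 4) ∧ q.2 ∈ ball x (ρ / 4) :=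
    ((continuous_fst.tendsto (x, x)).eventually (ball_mem_nhds x (by positivity))).and
      ((continuous_snd.tendsto (x, x)).eventually (ball_mem_nhds x (by positivity)))
  filter_upwards [hnear] with q hq
  -- Strict differentiability means a small Lipschitz constant for this remainder. It is at most (c
  -- / 8) ρ on the ball of radius ρ around `x`, so the Schwarz lemma on the ball of radius ρ / 2
  -- around `q.2` gives the constant c / 2.
  set k : E → F := fun y => f y - f x - fderiv ℂ f x (y - x) with hk
  have hsub : ball q.2 (ρ / 2) ⊆ ball x ρ := ball_subset_ball' (by
    have := mem_ball.1 hq.2; linarith)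
  have hkd : DifferentiableOn ℂ k (ball q.2 (ρ / 2)) := by
    refine ((hf.mono fun y hy => (hball y (hsub hy)).2).sub_const _).sub ?_
    exact ((fderiv ℂ f x).differentiable.comp (differentiable_id.sub_const x)).differentiableOn
  have hkb : ∀ y ∈ ball q.2 (ρ / 2), ‖k y‖ ≤ c / 8 * ρ := fun y hy => by
    refine (hball y (hsub hy)).1.trans ?_
    have := mem_ball_iff_norm.1 (hsub hy)
    gcongr
  have hq1 : q.1 ∈ ball q.2 (ρ / 2) := by
    have h1 := mem_ball.1 hq.1
    have h2 := mem_ball'.1 hq.2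
    rw [mem_ball]
    linarith [dist_triangle q.1 x q.2]
  have hfin := dist_le_of_bound hkd hkb hq1
  have e1 : k q.1 - k q.2 = f q.1 - f q.2 - fderiv ℂ f x (q.1 - q.2) := by
    simp only [hk, map_sub]; abel
  rw [e1] at hfin
  refine hfin.trans ?_
  have : 2 * (c / 8 * ρ) / (ρ / 2) = c / 2 := by field_simp; norm_num
  rw [this]
  gcongr
  linarith

end Holomorphic

/-- A contraction of a closed set of a complete space has a fixed point. -/
theorem exists_fixedPoint_of_contraction {X : Type*} [NormedAddCommGroup X] [CompleteSpace X]
    {s : Set X} (hs : IsClosed s) (hne : s.Nonempty) {T : X → X} (hT : Set.MapsTo T s s)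
    (hL : ∀ x ∈ s, ∀ y ∈ s, ‖T x - T y‖ ≤ 1 / 2 * ‖x - y‖) : ∃ x ∈ s, T x = x := by
  obtain ⟨x, hx⟩ := hne
  have hc : ContractingWith (1 / 2) (hT.restrict T s s) := by
    refine ⟨by rw [← NNReal.coe_lt_coe]; norm_num, LipschitzWith.of_dist_le_mul fun x y => ?_⟩
    rw [Subtype.dist_eq, Subtype.dist_eq, dist_eq_norm, dist_eq_norm]
    simpa using hL x x.2 y y.2
  obtain ⟨y, hy, hy', -⟩ := hc.exists_fixedPoint' hs.isComplete hT hx (edist_ne_top _ _)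
  exact ⟨y, hy, hy'⟩

/-! ### Sectors and a convergent series -/

section Sector

/-- The open sector `|Im z| < κ Re z`. -/
def sector (κ : ℝ) : Set ℂ := {z | |z.im| < κ * z.re}

theorem isOpen_sector (κ : ℝ) : IsOpen (sector κ) :=
  isOpen_lt (Complex.continuous_im.abs) (continuous_const.mul Complex.continuous_re)

theorem re_pos_of_mem_sector {κ : ℝ} (hκ : 0 < κ) {z : ℂ} (hz : z ∈ sector κ) : 0 < z.re := by
  have : |z.im| < κ * z.re := hz
  have := (abs_nonneg _).trans_lt this
  exact (mul_pos_iff_of_pos_left hκ).1 this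

theorem norm_le_two_mul_re {κ : ℝ} (hκ : 0 < κ) (hκ1 : κ ≤ 1) {z : ℂ} (hz : z ∈ sector κ) :
    ‖z‖ ≤ 2 * z.re := by
  have h0 := re_pos_of_mem_sector hκ hz
  have h1 : |z.im| < κ * z.re := hz
  have h2 := Complex.norm_le_abs_re_add_abs_im z
  rw [abs_of_pos h0] at h2
  nlinarith

theorem mem_sector_tan_iff {θ : ℝ} (hθ : 0 < θ) (hθ2 : θ < Real.pi / 2) {z : ℂ} (hz : z ≠ 0) :
    z ∈ sector (Real.tan θ) ↔ |z.arg| < θ := by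
  have htan := Real.tan_pos_of_pos_of_lt_pi_div_two hθ hθ2
  have key : ∀ {w : ℂ}, 0 < w.re → (w ∈ sector (Real.tan θ) ↔ |w.arg| < θ) := by
    intro w hw
    have harg : |w.arg| < Real.pi / 2 := Complex.abs_arg_lt_pi_div_two_iff.2 (Or.inl hw)
    have harg' := abs_lt.1 harg
    have : |w.im| < Real.tan θ * w.re ↔ |Real.tan w.arg| < Real.tan θ := by
      rw [Complex.tan_arg, abs_div, abs_of_pos hw, div_lt_iff₀ hw]
    change |w.im| < Real.tan θ * w.re ↔ _
    rw [this, abs_lt, abs_lt, ← Real.tan_neg]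
    have hm := Real.strictMonoOn_tan
    rw [hm.lt_iff_lt ⟨by linarith, by linarith⟩ ⟨harg'.1, harg'.2⟩,
      hm.lt_iff_lt ⟨harg'.1, harg'.2⟩ ⟨by linarith, by linarith⟩]
  constructor
  · intro h
    exact (key (re_pos_of_mem_sector htan h)).1 h
  · intro h
    have : 0 < z.re := (Complex.abs_arg_lt_pi_div_two_iff.1 (h.trans hθ2)).resolve_right hz
    exact (key this).2 h

theorem add_mem_sector {κ : ℝ} {z u : ℂ} (hz : z ∈ sector κ) (hu : |u.im| ≤ κ * u.re) :
    z + u ∈ sector κ := by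
  have h1 : |z.im| < κ * z.re := hz
  change |(z + u).im| < κ * (z + u).re
  rw [Complex.add_im, Complex.add_re]
  linarith [abs_add_le z.im u.im]

end Sector

/-- `∑_j ((1 + j) / 2) ^ (-1 - s)` converges for `s > 0`. -/
theorem summable_half_rpow {s : ℝ} (hs : 0 < s) :
    Summable fun j : ℕ => ((1 + (j : ℝ)) / 2) ^ (-1 - s) := by
  have h := (summable_nat_add_iff 1).2 (Real.summable_nat_rpow.2 (show -1 - s < -1 by linarith))
  refine (h.mul_right ((2 : ℝ)⁻¹ ^ (-1 - s))).congr fun j => ?_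
  rw [← Real.mul_rpow (by positivity) (by positivity)]
  congr 1
  push_cast
  ring

end FatouCoord

end

/-! ### The germ in logarithmic form -/

noncomputable section

namespace FatouCoord

open Filter Topology Metric

/-- The quotient `log (1 + s) / s`, continued analytically to `s = 0`. -/
def logQuot : ℂ → ℂ := dslope (fun s => Complex.log (1 + s)) 0

/-- The quotient `(exp s - 1) / s`, continued analytically to `s = 0`. -/
def expQuot : ℂ → ℂ := dslope Complex.exp 0

theorem analyticAt_dslope {f : ℂ → ℂ} {c : ℂ} (hf : AnalyticAt ℂ f c) :
    AnalyticAt ℂ (dslope f c) c := by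
  obtain ⟨p, hp⟩ := hf
  exact ⟨_, hp.has_fpower_series_dslope_fslope⟩

theorem analyticAt_logQuot : AnalyticAt ℂ logQuot 0 := by
  refine analyticAt_dslope ?_
  refine AnalyticAt.clog (analyticAt_const.add analyticAt_id) ?_
  simp

theorem analyticAt_expQuot : AnalyticAt ℂ expQuot 0 :=
  analyticAt_dslope analyticAt_cexp

theorem mul_logQuot (s : ℂ) : s * logQuot s = Complex.log (1 + s) := by
  have := sub_smul_dslope (fun s => Complex.log (1 + s)) 0 s
  simpa [logQuot] using this

theorem exp_eq_expQuot (s : ℂ) : Complex.exp s = 1 + s * expQuot s := by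
  have := sub_smul_dslope Complex.exp 0 s
  simp only [sub_zero, smul_eq_mul, Complex.exp_zero] at this
  rw [expQuot, this]
  ring

theorem logQuot_zero : logQuot 0 = 1 := by
  have h : HasDerivAt (fun s : ℂ => Complex.log (1 + s)) 1 0 := by
    have := ((hasDerivAt_id (0 : ℂ)).const_add 1).clog (by simp)
    simpa using this
  rw [logQuot, dslope_same, h.deriv]

theorem expQuot_zero : expQuot 0 = 1 := by
  rw [expQuot, dslope_same, Complex.deriv_exp, Complex.exp_zero]

section Monomials

variable {n : ℕ}

theorem monom_mul_exp (x c : Fin n → ℂ) (I : Fin n → ℕ) :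
    monom (fun i => x i * Complex.exp (c i)) I = monom x I * Complex.exp (pairing c I) := by
  simp only [monom, pairing, mul_pow, Finset.prod_mul_distrib, Complex.exp_sum]
  congr 1
  refine Finset.prod_congr rfl fun i _ => ?_
  rw [← Complex.exp_nat_mul, mul_comm]

theorem differentiable_monom (I : Fin n → ℕ) : Differentiable ℂ fun x => monom x I := by
  unfold monom
  fun_prop

theorem pairing_add (a b : Fin n → ℂ) (I : Fin n → ℕ) :
    pairing (fun i => a i + b i) I = pairing a I + pairing b I := by
  simp [pairing, add_mul, Finset.sum_add_distrib]

theorem pairing_mul (c : ℂ) (a : Fin n → ℂ) (I : Fin n → ℕ) :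
    pairing (fun i => c * a i) I = c * pairing a I := by
  simp [pairing, mul_assoc, Finset.mul_sum]

theorem pairing_sub_mul (a b : Fin n → ℂ) (c : ℂ) (I : Fin n → ℕ) :
    pairing (fun i => a i - b i * c) I = pairing a I - pairing b I * c := by
  simp only [pairing, sub_mul, Finset.sum_sub_distrib, Finset.sum_mul]
  congr 1
  exact Finset.sum_congr rfl fun i _ => by ring

theorem analyticAt_pairing {b : Fin n → (Fin n → ℂ) → ℂ} (hb : ∀ i, AnalyticAt ℂ (b i) 0)
    (I : Fin n → ℕ) : AnalyticAt ℂ (fun x => pairing (fun i => b i x) I) 0 := by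
  unfold pairing
  exact Finset.analyticAt_fun_sum _ fun i _ => (hb i).mul analyticAt_const

end Monomials

/-- The data and the hypotheses on the germ `f`. -/
structure Setup (n : ℕ) [NeZero n] where
  M : Fin n → ℕ
  a : Fin n → ℂ
  A : Fin n → (Fin n → ℂ) → ℂ
  hA : ∀ i, AnalyticAt ℂ (A i) 0
  hA0 : ∀ i, A i 0 = 0
  haM : pairing a M = -1
  γ : ℝ
  hγ : 0 < γ
  haγ : ∀ i, (a i).re + γ / gcdM M < 0
  ℓ : ℕ
  hM : ∀ i : Fin n, redM M i = 0 ↔ n - mbar M ≤ (i : ℕ)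
  P : Matrix (Fin n) (Fin n) ℕ
  hPdet : IsUnit (P.map (fun k : ℕ => (k : ℤ))).det
  hProw : P 0 = redM M
  hPblock : ∀ i j : Fin n, (n - mbar M ≤ (i : ℕ) ∨ n - mbar M ≤ (j : ℕ)) →
    P i j = if i = j then 1 else 0

namespace Setup

variable {n : ℕ} [NeZero n] (D : Setup n)

/-- The germ `f`. -/
def f : (Fin n → ℂ) → (Fin n → ℂ) := germMap D.M D.a D.A

/-- `x ^ M`. -/
def p (x : Fin n → ℂ) : ℂ := monom x D.M

/-- `x ^ m`. -/
def τ (x : Fin n → ℂ) : ℂ := monom x (redM D.M)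

/-- `1 / x ^ M`. -/
def Z (x : Fin n → ℂ) : ℂ := (D.p x)⁻¹

/-- `gcd M`. -/
def d : ℕ := gcdM D.M

/-- The exponent `γ / d`. -/
def q : ℝ := D.γ / gcdM D.M

/-- The branch of the logarithm of `1 / x ^ M` used on `U_ℓ`. -/
def Lam (z : ℂ) : ℂ := Complex.log z + 2 * Real.pi * Complex.I * D.ℓ

/-- `log (f_i (x) / x_i) = x ^ M (a_i + l_i (x))`. -/
def lhat (i : Fin n) (x : Fin n → ℂ) : ℂ :=
  (D.a i + D.A i x) * logQuot (D.p x * (D.a i + D.A i x)) - D.a i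

/-- `log (Z (f x) / Z x) = x ^ M (1 + ω (x))`. -/
def what (x : Fin n → ℂ) : ℂ := -pairing (fun i => D.lhat i x) D.M

/-- `Z (f x) = Z x + 1 + h (x)`. -/
def h (x : Fin n → ℂ) : ℂ := (1 + D.what x) * expQuot (D.p x * (1 + D.what x)) - 1

/-- The function `e_i` such that the `i`-th first integral is multiplied by
`exp (x ^ M e_i (x))` under `f`. -/
def corr (i : Fin n) (x : Fin n → ℂ) : ℂ := D.lhat i x - D.a i * D.what x

theorem exists_M_ne_zero : ∃ i, D.M i ≠ 0 := by
  by_contra hc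
  push Not at hc
  have := D.haM
  simp [pairing, hc] at this

theorem d_pos : 0 < D.d := by
  obtain ⟨i, hi⟩ := D.exists_M_ne_zero
  refine Nat.pos_of_ne_zero fun h0 => hi ?_
  have h0' : Finset.univ.gcd D.M = 0 := h0
  exact Finset.gcd_eq_zero_iff.1 h0' i (Finset.mem_univ i)

theorem d_ne_zero : (D.d : ℂ) ≠ 0 := Nat.cast_ne_zero.2 D.d_pos.ne'

theorem q_pos : 0 < D.q := div_pos D.hγ (Nat.cast_pos.2 D.d_pos)

theorem redM_mul (i : Fin n) : redM D.M i * D.d = D.M i :=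
  Nat.div_mul_cancel (Finset.gcd_dvd (Finset.mem_univ i))

theorem pairing_M (c : Fin n → ℂ) : pairing c D.M = D.d * pairing c (redM D.M) := by
  simp only [pairing, Finset.mul_sum]
  refine Finset.sum_congr rfl fun i _ => ?_
  rw [← D.redM_mul i]
  push_cast
  ring

theorem pairing_a_redM : pairing D.a (redM D.M) = -(D.d : ℂ)⁻¹ := by
  have h1 := D.haM
  rw [D.pairing_M] at h1
  have := D.d_ne_zero
  field_simp
  linear_combination h1

theorem p_eq (x : Fin n → ℂ) : D.p x = D.τ x ^ D.d := by
  simp only [p, τ, monom, ← Finset.prod_pow, ← pow_mul, D.redM_mul]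

theorem p_zero : D.p 0 = 0 := by
  obtain ⟨i, hi⟩ := D.exists_M_ne_zero
  exact Finset.prod_eq_zero (Finset.mem_univ i) (by simp [hi])

theorem analyticAt_p : AnalyticAt ℂ D.p 0 := by
  unfold p monom
  refine Finset.analyticAt_fun_prod _ fun i _ => ?_
  exact ((ContinuousLinearMap.proj (R := ℂ) (φ := fun _ : Fin n => ℂ) i).analyticAt 0).pow _

theorem analyticAt_lhat (i : Fin n) : AnalyticAt ℂ (D.lhat i) 0 := by
  have hG : AnalyticAt ℂ (fun x => D.a i + D.A i x) 0 := analyticAt_const.add (D.hA i)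
  refine (hG.mul (AnalyticAt.fun_comp ?_ (D.analyticAt_p.mul hG))).sub analyticAt_const
  simpa [D.p_zero] using analyticAt_logQuot

theorem lhat_zero (i : Fin n) : D.lhat i 0 = 0 := by
  simp [lhat, D.p_zero, D.hA0, logQuot_zero]

theorem analyticAt_what : AnalyticAt ℂ D.what 0 := (analyticAt_pairing D.analyticAt_lhat _).neg

theorem what_zero : D.what 0 = 0 := by simp [what, D.lhat_zero, pairing]

theorem analyticAt_corr (i : Fin n) : AnalyticAt ℂ (D.corr i) 0 :=
  (D.analyticAt_lhat i).sub (analyticAt_const.mul D.analyticAt_what)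

theorem corr_zero (i : Fin n) : D.corr i 0 = 0 := by simp [corr, D.lhat_zero, D.what_zero]

theorem analyticAt_h : AnalyticAt ℂ D.h 0 := by
  have hK : AnalyticAt ℂ (fun x => 1 + D.what x) 0 := analyticAt_const.add D.analyticAt_what
  refine (hK.mul (AnalyticAt.fun_comp ?_ (D.analyticAt_p.mul hK))).sub analyticAt_const
  simpa [D.p_zero] using analyticAt_expQuot

theorem h_zero : D.h 0 = 0 := by simp [h, D.p_zero, D.what_zero, expQuot_zero]

theorem pairing_corr (x : Fin n → ℂ) (I : Fin n → ℕ) :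
    pairing (fun i => D.corr i x) I
      = pairing (fun i => D.lhat i x) I - pairing D.a I * D.what x := by
  simp only [corr]
  exact pairing_sub_mul _ _ _ _

theorem pairing_corr_redM (x : Fin n → ℂ) : pairing (fun i => D.corr i x) (redM D.M) = 0 := by
  rw [D.pairing_corr, D.pairing_a_redM, what, D.pairing_M]
  have := D.d_ne_zero
  field_simp
  ring

/-- The properties of the points near the origin on which the formulas for `f` are valid. -/
structure Near (x : Fin n → ℂ) : Prop where
  germ : ∀ i, D.f x i = x i * Complex.exp (D.p x * (D.a i + D.lhat i x))
  small : ‖D.p x * (1 + D.what x)‖ ≤ 1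
  diff_f : DifferentiableAt ℂ D.f x
  diff_corr : ∀ i, DifferentiableAt ℂ (D.corr i) x
  diff_h : DifferentiableAt ℂ D.h x

theorem eventually_near : ∀ᶠ x in 𝓝 (0 : Fin n → ℂ), D.Near x := by
  have hG : ∀ i, AnalyticAt ℂ (fun x => D.p x * (D.a i + D.A i x)) 0 := fun i =>
    D.analyticAt_p.mul (analyticAt_const.add (D.hA i))
  have h1 : ∀ᶠ x in 𝓝 (0 : Fin n → ℂ), ∀ i, 1 + D.p x * (D.a i + D.A i x) ≠ 0 := by
    refine eventually_all.2 fun i => ?_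
    refine (continuousAt_const.add (hG i).continuousAt).eventually_ne ?_
    simp [D.p_zero]
  have h2 : ∀ᶠ x in 𝓝 (0 : Fin n → ℂ), ‖D.p x * (1 + D.what x)‖ < 1 := by
    have : ContinuousAt (fun x => ‖D.p x * (1 + D.what x)‖) 0 :=
      (D.analyticAt_p.mul (analyticAt_const.add D.analyticAt_what)).continuousAt.norm
    refine this.eventually_lt_const ?_
    simp [D.p_zero]
  have h3 : ∀ᶠ x in 𝓝 (0 : Fin n → ℂ), ∀ i, AnalyticAt ℂ (D.A i) x :=
    eventually_all.2 fun i => (D.hA i).eventually_analyticAt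
  have h4 : ∀ᶠ x in 𝓝 (0 : Fin n → ℂ), ∀ i, AnalyticAt ℂ (D.corr i) x :=
    eventually_all.2 fun i => (D.analyticAt_corr i).eventually_analyticAt
  filter_upwards [h1, h2, h3, h4, D.analyticAt_h.eventually_analyticAt]
    with x hx1 hx2 hx3 hx4 hx5
  refine ⟨fun i => ?_, hx2.le, ?_, fun i => (hx4 i).differentiableAt, hx5.differentiableAt⟩
  · have : D.p x * (D.a i + D.lhat i x) = Complex.log (1 + D.p x * (D.a i + D.A i x)) := by
      rw [← mul_logQuot, lhat]
      ring
    rw [this, Complex.exp_log (hx1 i)]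
    rfl
  · refine differentiableAt_pi.2 fun i => ?_
    change DifferentiableAt ℂ (fun x => x i * (1 + monom x D.M * (D.a i + D.A i x))) x
    have := (hx3 i).differentiableAt
    have := (differentiable_monom D.M) x
    fun_prop

/-- In logarithmic form f adds p (a_i + l_i) to log x_i, so its effect on a monomial is linear in
the exponent. -/
theorem Near.monom_f {x : Fin n → ℂ} (hx : D.Near x) (I : Fin n → ℕ) :
    monom (D.f x) I = monom x I *
      Complex.exp (D.p x * (pairing D.a I + pairing (fun i => D.lhat i x) I)) := by
  have : D.f x = fun i => x i * Complex.exp (D.p x * (D.a i + D.lhat i x)) :=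
    funext hx.germ
  rw [this, monom_mul_exp, pairing_mul, pairing_add]

theorem Near.p_f {x : Fin n → ℂ} (hx : D.Near x) :
    D.p (D.f x) = D.p x * Complex.exp (-(D.p x * (1 + D.what x))) := by
  rw [p, hx.monom_f, D.haM, what, p]
  congr 2
  ring

theorem Near.Z_f {x : Fin n → ℂ} (hx : D.Near x) :
    D.Z (D.f x) = D.Z x * Complex.exp (D.p x * (1 + D.what x)) := by
  rw [Z, hx.p_f, mul_inv, ← Complex.exp_neg, neg_neg, Z]

/-- With K = 1 + `what`, Z (exp(p K) - 1) = K `expQuot`(p K), because Z p = 1. -/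
theorem Near.Z_f_add {x : Fin n → ℂ} (hx : D.Near x) (h0 : D.p x ≠ 0) :
    D.Z (D.f x) = D.Z x + (1 + D.h x) := by
  rw [hx.Z_f, exp_eq_expQuot, h, Z]
  field_simp
  ring

/-- The principal branch does not jump: |arg Z| < π / 2 and the increment has modulus at most 1, so
the imaginary part stays within π / 2 + 1 < π. -/
theorem Near.log_Z_f {x : Fin n → ℂ} (hx : D.Near x) (h0 : 0 < (D.Z x).re) :
    Complex.log (D.Z (D.f x)) = Complex.log (D.Z x) + D.p x * (1 + D.what x) := by
  have hZ : D.Z x ≠ 0 := fun h => by simp [h] at h0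
  have harg := abs_lt.1 (Complex.abs_arg_lt_pi_div_two_iff.2 (Or.inl h0))
  have him := abs_le.1 ((Complex.abs_im_le_norm _).trans hx.small)
  have hpi := Real.pi_gt_three
  have e : D.Z (D.f x) = Complex.exp (Complex.log (D.Z x) + D.p x * (1 + D.what x)) := by
    rw [hx.Z_f, Complex.exp_add, Complex.exp_log hZ]
  rw [e, Complex.log_exp] <;> rw [Complex.add_im, Complex.log_im] <;> linarith

/-! ### The domain U and its invariance -/

/-- The domain `U_ℓ`, in terms of `Z = 1 / x ^ M`. -/
def U (κ R : ℝ) : Set (Fin n → ℂ) :=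
  {x | D.Z x ∈ sector κ ∧ R < ‖D.Z x‖ ∧ D.τ x = Complex.exp (-(D.Lam (D.Z x) / D.d)) ∧
    ∀ i, ‖x i‖ < ‖D.Z x‖ ^ (-D.q)}

theorem U_mono {κ κ' R R' : ℝ} (hκ : κ ≤ κ') (h0 : 0 < κ) (hR : R' ≤ R) :
    D.U κ R ⊆ D.U κ' R' := fun _ hx =>
  ⟨lt_of_lt_of_le hx.1 (mul_le_mul_of_nonneg_right hκ (re_pos_of_mem_sector h0 hx.1).le),
    hR.trans_lt hx.2.1, hx.2.2⟩

theorem norm_lt_of_mem_U {κ R : ℝ} (hR : 0 < R) {x : Fin n → ℂ} (hx : x ∈ D.U κ R) :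
    ‖x‖ < ‖D.Z x‖ ^ (-D.q) :=
  (pi_norm_lt_iff (Real.rpow_pos_of_pos (hR.trans hx.2.1) _)).2 hx.2.2.2

/-- On `U` the bound ‖x‖ < |Z|^(-q) shrinks the domain to the origin as R grows. This is how
statements about germs become statements on a whole domain. -/
theorem exists_forall_mem_U {Q : (Fin n → ℂ) → Prop} (hQ : ∀ᶠ x in 𝓝 0, Q x) :
    ∃ R₀ ≥ (1 : ℝ), ∀ κ R, R₀ ≤ R → ∀ x ∈ D.U κ R, Q x := by
  obtain ⟨δ, hδ, hball⟩ := Metric.eventually_nhds_iff_ball.1 hQ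
  have := (tendsto_rpow_neg_atTop D.q_pos).eventually_lt_const hδ
  obtain ⟨R₀, hR₀⟩ := eventually_atTop.1 (this.and (eventually_ge_atTop 1))
  refine ⟨max R₀ 1, le_max_right _ _, fun κ R hR x hx => hball x ?_⟩
  have hR1 : 1 ≤ R := (le_max_right _ _).trans hR
  rw [mem_ball_zero_iff]
  exact (D.norm_lt_of_mem_U (by linarith) hx).trans
    (hR₀ _ (((le_max_left _ _).trans hR).trans hx.2.1.le)).1

/-- The condition is open in κ, and at κ = 0 it is the hypothesis on γ. -/
theorem exists_aperture : ∃ κ₀ > 0, κ₀ ≤ 1 ∧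
    ∀ κ, 0 < κ → κ ≤ κ₀ → ∀ i, (D.a i).re + D.q + κ * |(D.a i).im| < 0 := by
  have h1 : ∀ᶠ κ : ℝ in 𝓝 0, ∀ i, (D.a i).re + D.q + κ * |(D.a i).im| < 0 := by
    refine eventually_all.2 fun i => ?_
    have : ContinuousAt (fun κ : ℝ => (D.a i).re + D.q + κ * |(D.a i).im|) 0 := by fun_prop
    refine this.eventually_lt_const ?_
    simpa [q] using D.haγ i
  obtain ⟨δ, hδ, hball⟩ := Metric.eventually_nhds_iff_ball.1 h1
  refine ⟨min (δ / 2) 1, by positivity, min_le_right _ _, fun κ hκ hle i => hball κ ?_ i⟩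
  rw [mem_ball_zero_iff, Real.norm_eq_abs, abs_of_pos hκ]
  linarith [hle.trans (min_le_left _ _)]

/-- The aperture of the sector in which `f` is analysed. -/
def κ₀ : ℝ := D.exists_aperture.choose

theorem κ₀_pos : 0 < D.κ₀ := D.exists_aperture.choose_spec.1

theorem κ₀_le : D.κ₀ ≤ 1 := D.exists_aperture.choose_spec.2.1

theorem κ₀_spec {κ : ℝ} (h0 : 0 < κ) (h1 : κ ≤ D.κ₀) (i : Fin n) :
    (D.a i).re + D.q + κ * |(D.a i).im| < 0 := D.exists_aperture.choose_spec.2.2 κ h0 h1 i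

/-- The estimates along the orbits in the domain `U κ R`. -/
structure Inv (κ R : ℝ) : Prop where
  κ_pos : 0 < κ
  κ_le : κ ≤ D.κ₀
  one_le : 1 ≤ R
  near : ∀ x ∈ D.U κ R, D.Near x
  mapsTo : Set.MapsTo D.f (D.U κ R) (D.U κ R)
  norm_le : ∀ x ∈ D.U κ R, ‖D.Z x‖ ≤ ‖D.Z (D.f x)‖
  re_le : ∀ x ∈ D.U κ R, (D.Z x).re + 1 / 2 ≤ (D.Z (D.f x)).re

theorem p_ne_zero_of_mem_U {κ R : ℝ} (hκ : 0 < κ) {x : Fin n → ℂ} (hx : x ∈ D.U κ R) :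
    D.p x ≠ 0 := by
  have h0 := re_pos_of_mem_sector hκ hx.1
  intro h
  simp [Z, h] at h0

theorem exists_inv {κ : ℝ} (hκ : 0 < κ) (hκ₀ : κ ≤ D.κ₀) :
    ∃ R₀ ≥ (1 : ℝ), ∀ R, R₀ ≤ R → D.Inv κ R := by
  have hκ1 : κ ≤ 1 := hκ₀.trans D.κ₀_le
  have h1 : ∀ᶠ x in 𝓝 (0 : Fin n → ℂ), ‖D.h x‖ < κ / 2 := by
    refine D.analyticAt_h.continuousAt.norm.eventually_lt_const ?_
    simpa [D.h_zero] using hκ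
  -- Multiplied by p, this quantity has as real part the change of log(|x_i| |Z|^q) under f. The
  -- inequality says that this real part is negative for p = 1 / Z with Z in the sector.
  have h2 : ∀ᶠ x in 𝓝 (0 : Fin n → ℂ), ∀ i,
      (D.a i + D.lhat i x + D.q * (1 + D.what x)).re
        + κ * |(D.a i + D.lhat i x + D.q * (1 + D.what x)).im| < 0 := by
    refine eventually_all.2 fun i => ?_
    have hc : ContinuousAt (fun x => D.a i + D.lhat i x + D.q * (1 + D.what x)) 0 := by
      have := (D.analyticAt_lhat i).continuousAt
      have := D.analyticAt_what.continuousAt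
      fun_prop
    have : ContinuousAt (fun x => (D.a i + D.lhat i x + D.q * (1 + D.what x)).re
        + κ * |(D.a i + D.lhat i x + D.q * (1 + D.what x)).im|) 0 :=
      (Complex.continuous_re.continuousAt.comp hc).add (continuousAt_const.mul
        (Complex.continuous_im.continuousAt.comp hc).abs)
    refine this.eventually_lt_const ?_
    simpa [D.lhat_zero, D.what_zero] using D.κ₀_spec hκ hκ₀ i
  obtain ⟨R₀, hR₀, hU⟩ := D.exists_forall_mem_U (D.eventually_near.and (h1.and h2))
  refine ⟨R₀, hR₀, fun R hR => ?_⟩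
  have hre : ∀ x ∈ D.U κ R, (D.Z x).re + 1 / 2 ≤ (D.Z (D.f x)).re := by
    intro x hx
    obtain ⟨hn, hh, -⟩ := hU κ R hR x hx
    rw [hn.Z_f_add _ (D.p_ne_zero_of_mem_U hκ hx), Complex.add_re, Complex.add_re, Complex.one_re]
    have := abs_le.1 (Complex.abs_re_le_norm (D.h x))
    linarith
  have hnorm : ∀ x ∈ D.U κ R, ‖D.Z x‖ ≤ ‖D.Z (D.f x)‖ := by
    intro x hx
    obtain ⟨hn, hh, -⟩ := hU κ R hR x hx
    have hre0 := re_pos_of_mem_sector hκ hx.1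
    have hle := norm_le_two_mul_re hκ hκ1 hx.1
    rw [hn.Z_f_add _ (D.p_ne_zero_of_mem_U hκ hx)]
    -- Re Z ≥ |Z| / 2 gives |Z + 1|² ≥ |Z|² + |Z| + 1 ≥ (|Z| + 1/2)², and |h| < 1/2 cannot undo this
    -- gain.
    have e1 : ‖D.Z x + 1‖ ≥ ‖D.Z x‖ + 1 / 2 := by
      refine le_of_sq_le_sq ?_ (norm_nonneg _)
      have e2 : ‖D.Z x + 1‖ ^ 2 = ‖D.Z x‖ ^ 2 + 2 * (D.Z x).re + 1 := by
        rw [Complex.sq_norm, Complex.sq_norm, Complex.normSq_apply, Complex.normSq_apply]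
        simp
        ring
      rw [e2]
      nlinarith
    have e3 := norm_sub_le (D.Z x + (1 + D.h x)) (D.h x)
    have e4 : D.Z x + (1 + D.h x) - D.h x = D.Z x + 1 := by ring
    rw [e4] at e3
    linarith
  refine ⟨hκ, hκ₀, hR₀.trans hR, fun x hx => (hU κ R hR x hx).1, fun x hx => ?_, hnorm, hre⟩
  obtain ⟨hn, hh, hc⟩ := hU κ R hR x hx
  have hp := D.p_ne_zero_of_mem_U hκ hx
  have hre0 := re_pos_of_mem_sector hκ hx.1
  have hZpos : 0 < ‖D.Z x‖ := norm_pos_iff.2 (inv_ne_zero hp)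
  refine ⟨?_, hx.2.1.trans_le (hnorm x hx), ?_, fun i => ?_⟩
  -- The step 1 + h stays in the closed sector: |Im h| ≤ κ / 2 ≤ κ (1 - κ / 2), as κ ≤ 1.
  · rw [hn.Z_f_add _ hp]
    refine add_mem_sector hx.1 ?_
    have e1 := (Complex.abs_im_le_norm (D.h x))
    have e2 := abs_le.1 (Complex.abs_re_le_norm (D.h x))
    simp only [Complex.add_im, Complex.one_im, zero_add, Complex.add_re, Complex.one_re]
    nlinarith
  · have e1 := hx.2.2.1
    rw [τ] at e1 ⊢
    rw [hn.monom_f, e1, Lam, Lam, hn.log_Z_f _ hre0, ← Complex.exp_add]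
    congr 1
    rw [D.pairing_a_redM, what, D.pairing_M]
    have := D.d_ne_zero
    field_simp
    ring
  · rw [hn.germ, hn.Z_f, norm_mul, norm_mul, Complex.norm_exp, Complex.norm_exp,
      Real.mul_rpow (norm_nonneg _) (Real.exp_pos _).le, ← Real.exp_mul]
    have hle : (D.p x * (D.a i + D.lhat i x)).re ≤ (D.p x * (1 + D.what x)).re * -D.q := by
      set c := D.a i + D.lhat i x + D.q * (1 + D.what x) with hcdef
      have e1 : (D.p x * c).re ≤ 0 := by
        have e2 : D.p x = (D.Z x)⁻¹ := by rw [Z, inv_inv]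
        rw [e2, Complex.mul_re, Complex.inv_re, Complex.inv_im]
        have e3 : (D.Z x).re * c.re + (D.Z x).im * c.im ≤ 0 := by
          have e4 : (D.Z x).im * c.im ≤ κ * (D.Z x).re * |c.im| := by
            refine (le_abs_self _).trans ?_
            rw [abs_mul]
            have : |(D.Z x).im| < κ * (D.Z x).re := hx.1
            gcongr
          have e5 := mul_neg_of_pos_of_neg hre0 (hc i)
          nlinarith
        have e6 : (D.Z x).re / Complex.normSq (D.Z x) * c.re
            - -(D.Z x).im / Complex.normSq (D.Z x) * c.im
            = ((D.Z x).re * c.re + (D.Z x).im * c.im) / Complex.normSq (D.Z x) := by ring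
        rw [e6]
        exact div_nonpos_of_nonpos_of_nonneg e3 (Complex.normSq_nonneg _)
      have e7 : D.p x * c = D.p x * (D.a i + D.lhat i x) + D.q * (D.p x * (1 + D.what x)) := by
        rw [hcdef]; ring
      rw [e7, Complex.add_re, Complex.re_ofReal_mul] at e1
      linarith
    refine mul_lt_mul (hx.2.2.2 i) (Real.exp_le_exp.2 hle) (Real.exp_pos _) ?_
    positivity

end Setup

end FatouCoord

end

/-! ### The domain U_ℓ and the limits of the first integrals -/

noncomputable section

namespace FatouCoord

open Filter Topology Metric

theorem exp_two_pi_mul_nat (ℓ : ℕ) : Complex.exp (2 * Real.pi * Complex.I * ℓ) = 1 := by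
  rw [mul_comm]
  exact_mod_cast Complex.exp_nat_mul_two_pi_mul_I ℓ

theorem exists_norm_le_of_analyticAt {n : ℕ} {g : (Fin n → ℂ) → ℂ} (hg : AnalyticAt ℂ g 0)
    (h0 : g 0 = 0) : ∃ C ≥ (0 : ℝ), ∀ᶠ x in 𝓝 0, ‖g x‖ ≤ C * ‖x‖ := by
  have := hg.differentiableAt.isBigO_sub
  obtain ⟨C, hC, hb⟩ := this.exists_nonneg
  refine ⟨C, hC, ?_⟩
  simpa [h0] using hb.bound

namespace Setup

variable {n : ℕ} [NeZero n] (D : Setup n)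

theorem rot_ne_zero : rot D.d D.ℓ ≠ 0 := Complex.exp_ne_zero _

theorem log_τ_mul_rot {x : Fin n → ℂ} (hre : 0 < (D.Z x).re)
    (hτ : D.τ x = Complex.exp (-(D.Lam (D.Z x) / D.d))) :
    Complex.log (D.τ x * rot D.d D.ℓ) = -(Complex.log (D.Z x) / D.d) := by
  have hd := D.d_ne_zero
  have hu : D.τ x * rot D.d D.ℓ = Complex.exp (-(Complex.log (D.Z x) / D.d)) := by
    rw [hτ, rot, ← Complex.exp_add, Lam]
    congr 1
    field_simp
    ring
  have harg := abs_lt.1 (Complex.abs_arg_lt_pi_div_two_iff.2 (Or.inl hre))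
  have hd1 : (1 : ℝ) ≤ D.d := Nat.one_le_cast.2 D.d_pos
  have him : (-(Complex.log (D.Z x) / D.d)).im = -((D.Z x).arg / D.d) := by
    rw [Complex.neg_im, Complex.div_natCast_im, Complex.log_im]
  have habs : |(D.Z x).arg / D.d| ≤ |(D.Z x).arg| := by
    rw [abs_div, Nat.abs_cast]
    exact div_le_self (abs_nonneg _) hd1
  have h1 := abs_lt.1 (habs.trans_lt (Complex.abs_arg_lt_pi_div_two_iff.2 (Or.inl hre)))
  have := Real.pi_pos
  rw [hu, Complex.log_exp] <;> rw [him] <;> linarith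

theorem norm_τ_rpow {x : Fin n → ℂ} : ‖D.τ x‖ ^ D.γ = ‖D.Z x‖ ^ (-D.q) := by
  have hd : (D.d : ℝ) ≠ 0 := Nat.cast_ne_zero.2 D.d_pos.ne'
  have h1 : ‖D.Z x‖ = (‖D.τ x‖ ^ (D.d : ℝ))⁻¹ := by
    rw [Z, p_eq, norm_inv, norm_pow, Real.rpow_natCast]
  rw [h1, Real.inv_rpow (by positivity), Real.rpow_neg (by positivity), inv_inv,
    ← Real.rpow_mul (norm_nonneg _)]
  congr 1
  rw [q, ← Setup.d]
  field_simp

/-- The rotation by ℓ is invisible in x^M; it only selects which d-th root of x^M the number x^m is.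
`U` records this choice as an equation for `τ` in terms of a branch of log Z. -/
theorem domU_eq {θ ε : ℝ} (hθ : 0 < θ) (hθ2 : θ < Real.pi / 2) (hε : 0 < ε) :
    domU D.M D.γ ε θ D.ℓ = D.U (Real.tan θ) ε⁻¹ := by
  have hd := D.d_ne_zero
  have hd0 : (0 : ℝ) < D.d := Nat.cast_pos.2 D.d_pos
  have hpi := Real.pi_pos
  have htan := Real.tan_pos_of_pos_of_lt_pi_div_two hθ hθ2
  ext x
  have hiff : x ∈ domU D.M D.γ ε θ D.ℓ ↔ ‖D.p x‖ < ε ∧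
      |(D.τ x * rot D.d D.ℓ).arg| < θ / D.d ∧ ∀ i, ‖x i‖ < ‖D.τ x‖ ^ D.γ := by
    rw [D.p_eq]
    rfl
  have hnorm : D.p x ≠ 0 → (‖D.p x‖ < ε ↔ ε⁻¹ < ‖D.Z x‖) := fun h => by
    rw [Z, norm_inv, inv_lt_inv₀ hε (norm_pos_iff.2 h)]
  rw [hiff]
  constructor
  · rintro ⟨h1, h2, h3⟩
    -- As γ > 0, the value 0 ^ γ is 0, and no norm is below it.
    have hτ : D.τ x ≠ 0 := by
      intro h
      have := h3 0
      rw [h, norm_zero, Real.zero_rpow D.hγ.ne'] at this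
      exact absurd this (norm_nonneg _).not_gt
    have hp : D.p x ≠ 0 := by rw [D.p_eq]; exact pow_ne_zero _ hτ
    have hu : D.τ x * rot D.d D.ℓ ≠ 0 := mul_ne_zero hτ D.rot_ne_zero
    set L := Complex.log (D.τ x * rot D.d D.ℓ) with hL
    have hLim : L.im = (D.τ x * rot D.d D.ℓ).arg := Complex.log_im _
    have hτL : D.τ x = Complex.exp (L - 2 * Real.pi * Complex.I * D.ℓ / D.d) := by
      rw [Complex.exp_sub, hL, Complex.exp_log hu, rot]
      field_simp
    have hZL : D.Z x = Complex.exp (-(D.d * L)) := by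
      rw [Z, D.p_eq, hτL, ← Complex.exp_nat_mul, ← Complex.exp_neg]
      have : -((D.d : ℂ) * (L - 2 * Real.pi * Complex.I * D.ℓ / D.d))
          = -(D.d * L) + 2 * Real.pi * Complex.I * D.ℓ := by
        field_simp
        ring
      rw [this, Complex.exp_add, exp_two_pi_mul_nat, mul_one]
    have him : (-((D.d : ℂ) * L)).im = -(D.d * L.im) := by simp
    have h2' : |D.d * L.im| < θ := by
      rw [hLim, abs_mul, Nat.abs_cast]
      rwa [lt_div_iff₀' hd0] at h2
    have h2'' := abs_lt.1 h2'
    -- The imaginary part d Im L is smaller than θ < π in modulus, so -d L is the principal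
    -- logarithm.
    have hlogZ : Complex.log (D.Z x) = -(D.d * L) := by
      rw [hZL, Complex.log_exp] <;> rw [him] <;> linarith
    refine ⟨?_, (hnorm hp).1 h1, ?_, fun i => by rw [← D.norm_τ_rpow]; exact h3 i⟩
    · rw [mem_sector_tan_iff hθ hθ2 (show D.Z x ≠ 0 from inv_ne_zero hp), ← Complex.log_im,
        hlogZ, him, abs_neg]
      exact h2'
    · rw [Lam, hlogZ, hτL]
      congr 1
      field_simp
      ring
  · rintro ⟨h1, h2, h3, h4⟩
    have hre := re_pos_of_mem_sector htan h1
    have hZ : D.Z x ≠ 0 := fun h => by simp [h] at hre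
    have hp : D.p x ≠ 0 := fun h => hZ (by simp [Z, h])
    refine ⟨(hnorm hp).2 h2, ?_, fun i => by rw [D.norm_τ_rpow]; exact h4 i⟩
    rw [← Complex.log_im, D.log_τ_mul_rot hre h3, Complex.neg_im, Complex.div_natCast_im,
      Complex.log_im, abs_neg, abs_div, Nat.abs_cast]
    have := (mem_sector_tan_iff hθ hθ2 hZ).1 h1
    gcongr

/-- The equation in the definition of `U` hides openness. Written as `domU` with θ = arctan κ, the
set is given by strict inequalities between functions continuous at its points. -/
theorem isOpen_U {κ R : ℝ} (hκ : 0 < κ) (hR : 0 < R) : IsOpen (D.U κ R) := by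
  have hθ : 0 < Real.arctan κ := Real.arctan_pos.2 hκ
  have hθ2 := Real.arctan_lt_pi_div_two κ
  have heq := D.domU_eq hθ hθ2 (inv_pos.2 hR)
  rw [Real.tan_arctan, inv_inv] at heq
  rw [← heq, isOpen_iff_mem_nhds]
  intro x hx
  have hτc : ContinuousAt D.τ x := (differentiable_monom (redM D.M)).continuous.continuousAt
  have hxU : x ∈ D.U κ R := heq ▸ hx
  have hτ0 : D.τ x ≠ 0 := by rw [hxU.2.2.1]; exact Complex.exp_ne_zero _
  have hd1 : (1 : ℝ) ≤ D.d := Nat.one_le_cast.2 D.d_pos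
  have hslit : D.τ x * rot D.d D.ℓ ∈ Complex.slitPlane := by
    refine Or.inl ?_
    refine (Complex.abs_arg_lt_pi_div_two_iff.1 ?_).resolve_right
      (mul_ne_zero hτ0 D.rot_ne_zero)
    exact hx.2.1.trans_le ((div_le_self hθ.le hd1).trans hθ2.le)
  have harg : ContinuousAt (fun y => |(D.τ y * rot D.d D.ℓ).arg|) x :=
    (ContinuousAt.comp' (f := fun y => D.τ y * rot D.d D.ℓ) (Complex.continuousAt_arg hslit)
      (hτc.mul continuousAt_const)).abs
  have hpow : ContinuousAt (fun y => ‖D.τ y‖ ^ D.γ) x :=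
    hτc.norm.rpow_const (Or.inl (norm_ne_zero_iff.2 hτ0))
  have hx3 : ∀ᶠ y in 𝓝 x, ∀ i, ‖y i‖ < ‖D.τ y‖ ^ D.γ := eventually_all.2 fun i =>
    ((continuous_apply i).continuousAt.norm).eventually_lt hpow (hx.2.2 i)
  filter_upwards [(hτc.pow D.d).norm.eventually_lt_const hx.1,
    harg.eventually_lt_const hx.2.1, hx3] with y h1 h2 h3
  exact ⟨h1, h2, h3⟩

/-- The chosen branch of log(x^m) is -`Lam`(Z) / d, and the factor d in the exponent cancels. -/
theorem firstIntegral_eq {κ R : ℝ} (hκ : 0 < κ) {x : Fin n → ℂ} (hx : x ∈ D.U κ R)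
    (I : Fin n → ℕ) : firstIntegral D.M D.a D.ℓ I x
      = monom x I * Complex.exp (-(pairing D.a I * D.Lam (D.Z x))) := by
  have hd := D.d_ne_zero
  have hlog := D.log_τ_mul_rot (re_pos_of_mem_sector hκ hx.1) hx.2.2.1
  have : logBranch D.d D.ℓ (D.τ x) = -(D.Lam (D.Z x) / D.d) := by
    rw [logBranch, hlog, Lam]
    field_simp
    ring
  change monom x I * Complex.exp ((D.d : ℂ) * pairing D.a I * logBranch D.d D.ℓ (D.τ x)) = _
  rw [this]
  congr 2
  field_simp

theorem Inv.iterate_mem {D : Setup n} {κ R : ℝ} (hI : D.Inv κ R) {x : Fin n → ℂ}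
    (hx : x ∈ D.U κ R) (j : ℕ) : D.f^[j] x ∈ D.U κ R := hI.mapsTo.iterate j hx

theorem Inv.re_iterate {D : Setup n} {κ R : ℝ} (hI : D.Inv κ R) {x : Fin n → ℂ}
    (hx : x ∈ D.U κ R) (j : ℕ) : (D.Z x).re + j / 2 ≤ (D.Z (D.f^[j] x)).re := by
  induction j with
  | zero => simp
  | succ j ih =>
    have := hI.re_le _ (hI.iterate_mem hx j)
    rw [Function.iterate_succ_apply']
    push_cast
    linarith

theorem Inv.differentiableOn_f {D : Setup n} {κ R : ℝ} (hI : D.Inv κ R) :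
    DifferentiableOn ℂ D.f (D.U κ R) := fun x hx =>
  (hI.near x hx).diff_f.differentiableWithinAt

/-- The sum of a function along the forward orbit. -/
def orbitSum (g : (Fin n → ℂ) → ℂ) (x : Fin n → ℂ) : ℂ := ∑' j, g (D.f^[j] x)

/-- The constant in the bound of `orbitSum`. -/
def orbitConst (s R : ℝ) : ℝ :=
  (R / 2) ^ (-(s / 2)) * ∑' j : ℕ, ((1 + (j : ℝ)) / 2) ^ (-1 - s / 2)

theorem tendsto_orbitConst {s : ℝ} (hs : 0 < s) : Tendsto (orbitConst s) atTop (𝓝 0) := by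
  unfold orbitConst
  have h := (tendsto_rpow_neg_atTop (half_pos hs)).comp
    (tendsto_id.atTop_div_const (two_pos : (0 : ℝ) < 2))
  simpa using h.mul_const (∑' j : ℕ, ((1 + (j : ℝ)) / 2) ^ (-1 - s / 2))

section OrbitSum

variable {D} {κ R s C : ℝ} (hI : D.Inv κ R) (hs : 0 < s) (hC : 0 ≤ C) {g : (Fin n → ℂ) → ℂ}
  (hb : ∀ y ∈ D.U κ R, ‖g y‖ ≤ C * ‖D.Z y‖ ^ (-1 - s))

-- Along the orbit |Z| is at least R / 2 and at least (1 + j) / 2. Splitting -1 - s as -s/2 + (-1 -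
-- s/2), the first factor makes the bound small for large R and the second makes it summable in j.
include hI hs hC hb in
theorem norm_orbit_le {x : Fin n → ℂ} (hx : x ∈ D.U κ R) (j : ℕ) :
    ‖g (D.f^[j] x)‖
      ≤ C * ((R / 2) ^ (-(s / 2)) * ((1 + (j : ℝ)) / 2) ^ (-1 - s / 2)) := by
  refine (hb _ (hI.iterate_mem hx j)).trans (mul_le_mul_of_nonneg_left ?_ hC)
  have hR := hI.one_le
  have h1 := hI.re_iterate hx j
  have h2 := norm_le_two_mul_re hI.κ_pos (hI.κ_le.trans D.κ₀_le) hx.1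
  have h3 := Complex.re_le_norm (D.Z (D.f^[j] x))
  have h4 := hx.2.1
  have hj : (0 : ℝ) ≤ j := j.cast_nonneg
  have hpos : 0 < ‖D.Z (D.f^[j] x)‖ := by linarith
  have e : -1 - s = -(s / 2) + (-1 - s / 2) := by ring
  rw [e, Real.rpow_add hpos]
  refine mul_le_mul ?_ ?_ (by positivity) (by positivity)
  · exact Real.rpow_le_rpow_of_nonpos (by linarith) (by linarith) (by linarith)
  · exact Real.rpow_le_rpow_of_nonpos (by linarith) (by linarith) (by linarith)

include hI hs hC hb in
theorem summable_orbit {x : Fin n → ℂ} (hx : x ∈ D.U κ R) :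
    Summable fun j => g (D.f^[j] x) :=
  Summable.of_norm_bounded (((summable_half_rpow (half_pos hs)).mul_left _).mul_left C)
    fun j => norm_orbit_le hI hs hC hb hx j

include hI hs hC hb in
theorem norm_orbitSum_le {x : Fin n → ℂ} (hx : x ∈ D.U κ R) :
    ‖D.orbitSum g x‖ ≤ C * orbitConst s R := by
  have hu := ((summable_half_rpow (half_pos hs)).mul_left ((R / 2) ^ (-(s / 2)))).mul_left C
  refine (tsum_of_norm_bounded hu.hasSum fun j => norm_orbit_le hI hs hC hb hx j).trans_eq ?_
  rw [tsum_mul_left, tsum_mul_left, orbitConst]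

include hI hs hC hb in
theorem differentiableOn_orbitSum (hg : DifferentiableOn ℂ g (D.U κ R)) :
    DifferentiableOn ℂ (D.orbitSum g) (D.U κ R) :=
  differentiableOn_tsum_of_bound
    (D.isOpen_U hI.κ_pos (by linarith [hI.one_le]))
    (((summable_half_rpow (half_pos hs)).mul_left _).mul_left C)
    (fun j => hg.comp (hI.differentiableOn_f.iterate hI.mapsTo j) (hI.mapsTo.iterate j))
    fun j _ hx => norm_orbit_le hI hs hC hb hx j

include hI hs hC hb in
theorem orbitSum_eq_add {x : Fin n → ℂ} (hx : x ∈ D.U κ R) :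
    D.orbitSum g x = g x + D.orbitSum g (D.f x) := by
  rw [orbitSum, (summable_orbit hI hs hC hb hx).tsum_eq_zero_add]
  simp [orbitSum]

end OrbitSum

/-- `H_i (x)` is the logarithm of the factor by which the `i`-th first integral of the leading
part has to be multiplied to become invariant. -/
def H (i : Fin n) : (Fin n → ℂ) → ℂ := D.orbitSum fun x => D.p x * D.corr i x

/-- `Inv`, together with the convergence of the series that define `H`. -/
structure Tame (κ R : ℝ) : Prop extends D.Inv κ R where
  summable : ∀ i, ∀ x ∈ D.U κ R, Summable fun j => D.p (D.f^[j] x) * D.corr i (D.f^[j] x)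
  diff_H : ∀ i, DifferentiableOn ℂ (D.H i) (D.U κ R)
  H_le : ∀ i, ∀ x ∈ D.U κ R, ‖D.H i x‖ ≤ 1 / 16

theorem exists_tame {κ : ℝ} (hκ : 0 < κ) (hκ₀ : κ ≤ D.κ₀) :
    ∃ R₀ ≥ (1 : ℝ), ∀ R, R₀ ≤ R → D.Tame κ R := by
  have h1 : ∀ i, ∃ C ≥ (0 : ℝ), ∀ᶠ x in 𝓝 0, ‖D.corr i x‖ ≤ C * ‖x‖ := fun i =>
    exists_norm_le_of_analyticAt (D.analyticAt_corr i) (D.corr_zero i)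
  choose C hC hCb using h1
  obtain ⟨R₁, hR₁, hb⟩ := D.exists_forall_mem_U (eventually_all.2 hCb)
  obtain ⟨R₂, hR₂, hInv⟩ := D.exists_inv hκ hκ₀
  have h2 : ∀ i, ∀ᶠ R in atTop, C i * orbitConst D.q R < 1 / 16 := fun i => by
    have := (tendsto_orbitConst D.q_pos).const_mul (C i)
    rw [mul_zero] at this
    exact this.eventually_lt_const (by norm_num)
  obtain ⟨R₃, hR₃⟩ := eventually_atTop.1 (eventually_all.2 h2)
  refine ⟨max R₁ (max R₂ R₃), hR₁.trans (le_max_left _ _), fun R hR => ?_⟩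
  have hI := hInv R (((le_max_left _ _).trans (le_max_right _ _)).trans hR)
  -- The factor p contributes |Z|^(-1), and `corr i` vanishes at 0, which contributes ‖x‖ ≤
  -- |Z|^(-q).
  have hbd : ∀ i, ∀ y ∈ D.U κ R, ‖D.p y * D.corr i y‖ ≤ C i * ‖D.Z y‖ ^ (-1 - D.q) := by
    intro i y hy
    have e1 := hb κ R ((le_max_left _ _).trans hR) y hy i
    have e2 := D.norm_lt_of_mem_U (by linarith [hI.one_le]) hy
    have hZ : 0 < ‖D.Z y‖ := by linarith [hI.one_le, hy.2.1]
    have e3 : ‖D.p y‖ = ‖D.Z y‖ ^ (-1 : ℝ) := by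
      rw [Real.rpow_neg_one, Z, norm_inv, inv_inv]
    have hCi := hC i
    rw [norm_mul, sub_eq_add_neg, Real.rpow_add hZ, e3]
    calc ‖D.Z y‖ ^ (-1 : ℝ) * ‖D.corr i y‖
        ≤ ‖D.Z y‖ ^ (-1 : ℝ) * (C i * ‖D.Z y‖ ^ (-D.q)) := by
          gcongr
          exact e1.trans (by gcongr)
      _ = _ := by ring
  refine ⟨hI, fun i x hx => ?_, fun i => ?_, fun i x hx => ?_⟩
  · exact summable_orbit hI D.q_pos (hC i) (hbd i) hx
  · refine differentiableOn_orbitSum hI D.q_pos (hC i) (hbd i) fun y hy => ?_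
    exact (((differentiable_monom D.M) y).mul
      ((hI.near y hy).diff_corr i)).differentiableWithinAt
  · exact (norm_orbitSum_le hI D.q_pos (hC i) (hbd i) hx).trans
      (hR₃ R (((le_max_right _ _).trans (le_max_right _ _)).trans hR) i).le

/-- The limit of the first integrals along the orbits. -/
def psiLim (I : Fin n → ℕ) (x : Fin n → ℂ) : ℂ :=
  monom x I * Complex.exp (pairing (fun i => D.H i x) I)
    * Complex.exp (-(pairing D.a I * D.Lam (D.Z x)))

section Limits

variable {D} {κ R : ℝ} (hT : D.Tame κ R)

include hT in
theorem Tame.tendsto_pairing {x : Fin n → ℂ} (hx : x ∈ D.U κ R) (I : Fin n → ℕ) :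
    Tendsto (fun k => ∑ j ∈ Finset.range k,
      D.p (D.f^[j] x) * pairing (fun i => D.corr i (D.f^[j] x)) I)
      atTop (𝓝 (pairing (fun i => D.H i x) I)) := by
  have h1 : Tendsto (fun k => pairing (fun i => ∑ j ∈ Finset.range k,
      D.p (D.f^[j] x) * D.corr i (D.f^[j] x)) I) atTop (𝓝 (pairing (fun i => D.H i x) I)) := by
    unfold pairing
    exact tendsto_finsetSum _ fun i _ =>
      ((hT.summable i x hx).hasSum.tendsto_sum_nat).mul_const _
  refine h1.congr fun k => ?_
  simp only [pairing, Finset.sum_mul, Finset.mul_sum]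
  rw [Finset.sum_comm]
  exact Finset.sum_congr rfl fun i _ => Finset.sum_congr rfl fun j _ => by ring

-- Every term of the orbit sum already pairs to zero with m. Hence replacing x_i by x_i exp(H_i)
-- does not change x^m, nor Z.
include hT in
theorem Tame.pairing_H_redM {x : Fin n → ℂ} (hx : x ∈ D.U κ R) :
    pairing (fun i => D.H i x) (redM D.M) = 0 := by
  have := hT.tendsto_pairing hx (redM D.M)
  simp only [D.pairing_corr_redM, mul_zero, Finset.sum_const_zero] at this
  exact (tendsto_nhds_unique this tendsto_const_nhds)

-- Under one step the monomial gains p ⟨a + l, I⟩ in its exponent, and -⟨a, I⟩ log Z changes by -⟨a,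
-- I⟩ p (1 + `what`). The terms p ⟨a, I⟩ cancel and p ⟨`corr`, I⟩ is left.
include hT in
theorem Tame.firstIntegral_iterate {x : Fin n → ℂ} (hx : x ∈ D.U κ R) (I : Fin n → ℕ) (k : ℕ) :
    firstIntegral D.M D.a D.ℓ I (D.f^[k] x)
      = firstIntegral D.M D.a D.ℓ I x * Complex.exp (∑ j ∈ Finset.range k,
        D.p (D.f^[j] x) * pairing (fun i => D.corr i (D.f^[j] x)) I) := by
  induction k with
  | zero => simp
  | succ k ih =>
    have hy := hT.iterate_mem hx k
    rw [Finset.sum_range_succ, Complex.exp_add, ← mul_assoc, ← ih, Function.iterate_succ_apply',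
      D.firstIntegral_eq hT.κ_pos (hT.mapsTo hy), D.firstIntegral_eq hT.κ_pos hy]
    have hn := hT.near _ hy
    rw [hn.monom_f, Lam, hn.log_Z_f _ (re_pos_of_mem_sector hT.κ_pos hy.1),
      mul_assoc (monom _ I), mul_assoc (monom _ I), ← Complex.exp_add, ← Complex.exp_add,
      D.pairing_corr, Lam]
    congr 2
    ring

include hT in
theorem Tame.tendsto_firstIntegral {x : Fin n → ℂ} (hx : x ∈ D.U κ R) (I : Fin n → ℕ) :
    Tendsto (fun k => firstIntegral D.M D.a D.ℓ I (D.f^[k] x)) atTop (𝓝 (D.psiLim I x)) := by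
  simp only [hT.firstIntegral_iterate hx I]
  have := ((hT.tendsto_pairing hx I).cexp).const_mul (firstIntegral D.M D.a D.ℓ I x)
  refine this.trans_eq ?_
  rw [D.firstIntegral_eq hT.κ_pos hx, psiLim]
  congr 1
  ring

include hT in
theorem Tame.psi_eq {x : Fin n → ℂ} (hx : x ∈ D.U κ R) (I : Fin n → ℕ) :
    psi D.M D.a D.A D.ℓ I x = D.psiLim I x := (hT.tendsto_firstIntegral hx I).limUnder_eq

include hT in
theorem Tame.psiLim_f {x : Fin n → ℂ} (hx : x ∈ D.U κ R) (I : Fin n → ℕ) :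
    D.psiLim I (D.f x) = D.psiLim I x := by
  have h1 := hT.tendsto_firstIntegral (hT.mapsTo hx) I
  simp only [← Function.iterate_succ_apply] at h1
  exact tendsto_nhds_unique h1
    ((tendsto_add_atTop_iff_nat 1).2 (hT.tendsto_firstIntegral hx I))

end Limits

end Setup

end FatouCoord

end

/-! ### Monomial maps with unimodular exponents -/

noncomputable section

namespace FatouCoord

open Filter Topology Metric

section Toric

theorem prod_zpow_eq_zpow_sum {ι : Type*} (s : Finset ι) {v : ℂ} (hv : v ≠ 0) (e : ι → ℤ) :
    ∏ j ∈ s, v ^ e j = v ^ ∑ j ∈ s, e j := by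
  classical
  induction s using Finset.induction_on with
  | empty => simp
  | insert j s hj ih => rw [Finset.prod_insert hj, Finset.sum_insert hj, zpow_add₀ hv, ih]

/-- Composition of monomial maps corresponds to the product of the matrices of exponents, as long
as the coordinates that may vanish enter in the trivial way. -/
theorem zmonom_comp {n K : ℕ} (S B : Matrix (Fin n) (Fin n) ℤ) {v : Fin n → ℂ}
    (hv : ∀ k : Fin n, (k : ℕ) < K → v k ≠ 0)
    (hB : ∀ j k : Fin n, K ≤ (k : ℕ) → B j k = if j = k then 1 else 0) (i : Fin n) :
    ∏ j, (∏ k, v k ^ B j k) ^ S i j = ∏ k, v k ^ (S * B) i k := by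
  simp_rw [← Finset.prod_zpow, ← zpow_mul]
  rw [Finset.prod_comm]
  refine Finset.prod_congr rfl fun k _ => ?_
  rcases lt_or_ge (k : ℕ) K with hk | hk
  · rw [prod_zpow_eq_zpow_sum _ (hv k hk), Matrix.mul_apply]
    congr 1
    exact Finset.sum_congr rfl fun j _ => mul_comm _ _
  · rw [Matrix.mul_apply]
    simp only [hB _ k hk]
    rw [Finset.prod_eq_single k (by intro j _ hj; simp [hj]) (by simp)]
    simp

theorem zmonom_one {n : ℕ} (v : Fin n → ℂ) (i : Fin n) :
    ∏ k, v k ^ (1 : Matrix (Fin n) (Fin n) ℤ) i k = v i := by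
  rw [Finset.prod_eq_single i (by intro j _ hj; simp [Matrix.one_apply_ne hj.symm]) (by simp)]
  simp

theorem prod_erase_zero_eq {n : ℕ} [NeZero n] (y : Fin n → ℂ) (J : Fin n → ℤ) :
    ∏ j ∈ Finset.univ.erase 0, y j ^ J j = ∏ j, Function.update y 0 1 j ^ J j := by
  rw [← Finset.mul_prod_erase Finset.univ _ (Finset.mem_univ (0 : Fin n))]
  simp only [Function.update_self, one_zpow, one_mul]
  refine Finset.prod_congr rfl fun j hj => ?_
  rw [Function.update_of_ne (Finset.ne_of_mem_erase hj)]

end Toric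

namespace Setup

variable {n : ℕ} [NeZero n] (D : Setup n)

/-- The matrix `P`, with integer entries. -/
def PZ : Matrix (Fin n) (Fin n) ℤ := D.P.map (fun k : ℕ => (k : ℤ))

theorem PZ_mul_invZ : D.PZ * invZ D.P = 1 := Matrix.mul_nonsing_inv _ D.hPdet

theorem invZ_mul_PZ : invZ D.P * D.PZ = 1 := Matrix.nonsing_inv_mul _ D.hPdet

theorem PZ_block (j k : Fin n) (hk : n - mbar D.M ≤ (k : ℕ)) :
    D.PZ j k = if j = k then 1 else 0 := by
  simp only [PZ, Matrix.map_apply, D.hPblock j k (Or.inr hk)]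
  split_ifs <;> simp

/-- The last m̄ columns of P are unit vectors, and P⁻¹ fixes these vectors. Thus the coordinates
that may vanish never receive a negative exponent. -/
theorem invZ_block (j k : Fin n) (hk : n - mbar D.M ≤ (k : ℕ)) :
    invZ D.P j k = if j = k then 1 else 0 := by
  have h := congrFun (congrFun D.invZ_mul_PZ j) k
  rw [Matrix.mul_apply, Matrix.one_apply] at h
  rw [← h]
  simp only [D.PZ_block _ k hk]
  simp

theorem monom_P (v : Fin n → ℂ) (k : Fin n) : monom v (D.P k) = ∏ j, v j ^ D.PZ k j := by
  simp [monom, PZ]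

theorem update_ne_zero {y : Fin n → ℂ} (hy : y ∈ modelSpace D.M) (j : Fin n)
    (hj : (j : ℕ) < n - mbar D.M) : Function.update y 0 1 j ≠ 0 := by
  by_cases h0 : j = 0
  · subst h0
    simp
  · rw [Function.update_of_ne h0]
    exact hy j (Nat.one_le_iff_ne_zero.2 fun h => h0 (Fin.ext h)) hj

/-- The point with `1 / x ^ M = y_0` at which the leading parts of the first integrals take the
values `y_j`. -/
def X (y : Fin n → ℂ) (i : Fin n) : ℂ :=
  (∏ j ∈ Finset.univ.erase 0, y j ^ invZ D.P i j) * Complex.exp (D.a i * D.Lam (y 0))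

theorem X_eq (y : Fin n → ℂ) : D.X y = fun i =>
    (∏ j, Function.update y 0 1 j ^ invZ D.P i j) * Complex.exp (D.a i * D.Lam (y 0)) := by
  funext i
  rw [X, prod_erase_zero_eq]

theorem pairing_mul_right (c : ℂ) (I : Fin n → ℕ) :
    pairing (fun i => D.a i * c) I = pairing D.a I * c := by
  simp only [mul_comm _ c, pairing_mul]

theorem monom_X {y : Fin n → ℂ} (hy : y ∈ modelSpace D.M) (k : Fin n) :
    monom (D.X y) (D.P k)
      = Function.update y 0 1 k * Complex.exp (pairing D.a (D.P k) * D.Lam (y 0)) := by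
  rw [X_eq, monom_mul_exp, pairing_mul_right, D.monom_P,
    zmonom_comp D.PZ (invZ D.P) (D.update_ne_zero hy) D.invZ_block, D.PZ_mul_invZ, zmonom_one]

/-- Once the factors exp(a_i `Lam`) are divided out, the hypothesis is a system of monomial
equations with exponent matrix P, which the inverse matrix solves. -/
theorem eq_X_of_monom {x y : Fin n → ℂ}
    (hx : ∀ j : Fin n, (j : ℕ) < n - mbar D.M → x j ≠ 0)
    (h : ∀ k, monom x (D.P k)
      = Function.update y 0 1 k * Complex.exp (pairing D.a (D.P k) * D.Lam (y 0))) :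
    x = D.X y := by
  set v : Fin n → ℂ := fun i => x i * Complex.exp (D.a i * -D.Lam (y 0)) with hv
  have hvP : ∀ k, ∏ j, v j ^ D.PZ k j = Function.update y 0 1 k := fun k => by
    rw [← D.monom_P, hv, monom_mul_exp, pairing_mul_right, h k, mul_assoc, ← Complex.exp_add]
    simp
  rw [X_eq]
  funext i
  simp_rw [← hvP]
  rw [zmonom_comp (invZ D.P) D.PZ (K := n - mbar D.M) (fun j hj =>
    mul_ne_zero (hx j hj) (Complex.exp_ne_zero _)) D.PZ_block, D.invZ_mul_PZ, zmonom_one,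
    mul_assoc, ← Complex.exp_add]
  simp

theorem τ_X {y : Fin n → ℂ} (hy : y ∈ modelSpace D.M) :
    D.τ (D.X y) = Complex.exp (-(D.Lam (y 0) / D.d)) := by
  rw [τ, ← D.hProw, D.monom_X hy, D.hProw, D.pairing_a_redM]
  simp only [Function.update_self, one_mul]
  congr 1
  ring

theorem ne_zero_of_τ_ne_zero {x : Fin n → ℂ} (hx : D.τ x ≠ 0) (j : Fin n)
    (hj : (j : ℕ) < n - mbar D.M) : x j ≠ 0 := by
  have h1 : redM D.M j ≠ 0 := fun h => absurd ((D.hM j).1 h) (not_le.2 hj)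
  have hx' : ∏ i, x i ^ redM D.M i ≠ 0 := hx
  have h2 := Finset.prod_ne_zero_iff.1 hx' j (Finset.mem_univ j)
  exact fun h => h2 (by rw [h, zero_pow h1])

/-- The map `Φ_ℓ`. -/
def Ph : (Fin n → ℂ) → (Fin n → ℂ) := Phi D.M D.a D.A D.P D.ℓ

theorem psiLim_eq (I : Fin n → ℕ) (x : Fin n → ℂ) :
    D.psiLim I x = monom (fun i => x i * Complex.exp (D.H i x)) I
      * Complex.exp (-(pairing D.a I * D.Lam (D.Z x))) := by
  rw [monom_mul_exp, psiLim]

/-- By `psiLim_eq`, ψ_I is the leading integral at the corrected point x_i exp(H_i(x)). The rows of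
P together with the value of Z then determine that point, and it is `X y`. -/
theorem Tame.Ph_eq_iff {D : Setup n} {κ R : ℝ} (hT : D.Tame κ R) {x y : Fin n → ℂ}
    (hx : x ∈ D.U κ R) (hy : y ∈ modelSpace D.M) :
    D.Ph x = y ↔ D.Z x = y 0 ∧ ∀ i, x i * Complex.exp (D.H i x) = D.X y i := by
  have hval : ∀ k, D.Ph x k = if k = 0 then D.Z x else D.psiLim (D.P k) x := fun k => by
    rw [Ph, Phi]
    split_ifs with h
    · rw [Z, p, one_div]
    · exact hT.psi_eq hx _
  -- This covers the row 0 of P, which is m: the correction by H leaves x^m unchanged.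
  have hτ : monom (fun i => x i * Complex.exp (D.H i x)) (redM D.M) = D.τ x := by
    rw [monom_mul_exp, hT.pairing_H_redM hx, Complex.exp_zero, mul_one, τ]
  constructor
  · rintro rfl
    have h0 : D.Z x = D.Ph x 0 := by rw [hval, if_pos rfl]
    refine ⟨h0, fun i => ?_⟩
    refine congrFun (D.eq_X_of_monom (x := fun i => x i * Complex.exp (D.H i x)) ?_
      fun k => ?_) i
    · refine D.ne_zero_of_τ_ne_zero ?_
      rw [τ, hτ, hx.2.2.1]
      exact Complex.exp_ne_zero _
    · rw [← h0]
      by_cases hk : k = 0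
      · subst hk
        rw [Function.update_self, D.hProw, hτ, hx.2.2.1, D.pairing_a_redM, one_mul]
        congr 1
        ring
      · rw [Function.update_of_ne hk, hval, if_neg hk, D.psiLim_eq, mul_assoc,
          ← Complex.exp_add]
        simp
  · rintro ⟨h0, h1⟩
    funext k
    rw [hval]
    split_ifs with hk
    · rw [h0, hk]
    · rw [D.psiLim_eq, funext h1, D.monom_X hy, Function.update_of_ne hk, mul_assoc,
        ← Complex.exp_add, h0]
      simp

/-- The domain `V`. -/
def V (κ R r : ℝ) : Set (Fin n → ℂ) :=
  {y | y ∈ modelSpace D.M ∧ y 0 ∈ sector κ ∧ R < ‖y 0‖ ∧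
    ∀ i, ‖∏ j ∈ Finset.univ.erase 0, y j ^ invZ D.P i j‖ < r * ‖y 0‖ ^ (-D.q - (D.a i).re)}

theorem domV_eq {θ ε r : ℝ} (hθ : 0 < θ) (hθ2 : θ < Real.pi / 2) (hε : 0 < ε) :
    domV D.M D.a D.P D.γ ε θ r = D.V (Real.tan θ) ε⁻¹ r := by
  ext y
  have hiff : 0 < ‖y 0‖ → (|(y 0).arg| < θ ↔ y 0 ∈ sector (Real.tan θ)) := fun h =>
    (mem_sector_tan_iff hθ hθ2 (norm_pos_iff.1 h)).symm
  have hpos := inv_pos.2 hε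
  constructor
  · rintro ⟨h1, h2, h3, h4⟩
    exact ⟨h1, (hiff (hpos.trans h2)).1 h3, h2, h4⟩
  · rintro ⟨h1, h2, h3, h4⟩
    exact ⟨h1, h3, (hiff (hpos.trans h3)).2 h2, h4⟩

theorem V_mono {κ κ' R R' r r' : ℝ} (hκ : κ ≤ κ') (h0 : 0 < κ) (hR : R' ≤ R) (hr : r ≤ r') :
    D.V κ R r ⊆ D.V κ' R' r' := fun y hy =>
  ⟨hy.1, lt_of_lt_of_le hy.2.1
    (mul_le_mul_of_nonneg_right hκ (re_pos_of_mem_sector h0 hy.2.1).le), hR.trans_lt hy.2.2.1,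
    fun i => (hy.2.2.2 i).trans_le (by gcongr)⟩

theorem isOpen_modelSpace {n : ℕ} (M : Fin n → ℕ) : IsOpen (modelSpace M) := by
  simp only [modelSpace, Set.ofPred_forall]
  refine isOpen_iInter_of_finite fun j => isOpen_iInter_of_finite fun _ =>
    isOpen_iInter_of_finite fun _ => ?_
  exact isOpen_ne_fun (continuous_apply j) continuous_const

/-- A coordinate is either nonzero on `modelSpace` or enters with exponent 0 or 1. -/
theorem differentiableAt_zprod {y : Fin n → ℂ} (hy : y ∈ modelSpace D.M) (i : Fin n) :
    DifferentiableAt ℂ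
      (fun y : Fin n → ℂ => ∏ j ∈ Finset.univ.erase 0, y j ^ invZ D.P i j) y := by
  have h : ∀ j ∈ Finset.univ.erase (0 : Fin n),
      DifferentiableAt ℂ (fun y : Fin n → ℂ => y j ^ invZ D.P i j) y := fun j hj => by
    have hproj : DifferentiableAt ℂ (fun y : Fin n → ℂ => y j) y := differentiableAt_apply j y
    rcases lt_or_ge (j : ℕ) (n - mbar D.M) with h | h
    · refine hproj.zpow (Or.inl (hy j ?_ h))
      exact Nat.one_le_iff_ne_zero.2 fun h0 => Finset.ne_of_mem_erase hj (Fin.ext h0)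
    · refine hproj.zpow (Or.inr ?_)
      rw [D.invZ_block _ _ h]
      split_ifs <;> norm_num
  exact (HasFDerivAt.finsetProd fun j hj => (h j hj).hasFDerivAt).differentiableAt

theorem isOpen_V {κ R r : ℝ} (hR : 0 < R) : IsOpen (D.V κ R r) := by
  rw [isOpen_iff_mem_nhds]
  intro y hy
  have h0 : ContinuousAt (fun y : Fin n → ℂ => y 0) y := continuousAt_apply 0 y
  have hne : ‖y 0‖ ≠ 0 := (hR.trans hy.2.2.1).ne'
  have h4 : ∀ᶠ y in 𝓝 y, ∀ i, ‖∏ j ∈ Finset.univ.erase 0, y j ^ invZ D.P i j‖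
      < r * ‖y 0‖ ^ (-D.q - (D.a i).re) := eventually_all.2 fun i =>
    (D.differentiableAt_zprod hy.1 i).continuousAt.norm.eventually_lt
      (continuousAt_const.mul (h0.norm.rpow_const (Or.inl hne))) (hy.2.2.2 i)
  filter_upwards [(isOpen_modelSpace D.M).mem_nhds hy.1, h0 ((isOpen_sector κ).mem_nhds hy.2.1),
    h0.norm.eventually_const_lt hy.2.2.1, h4] with y h1 h2 h3 h4
  exact ⟨h1, h2, h3, h4⟩

theorem differentiableAt_X {κ R r : ℝ} (hκ : 0 < κ) {y : Fin n → ℂ} (hy : y ∈ D.V κ R r) :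
    DifferentiableAt ℂ D.X y := by
  refine differentiableAt_pi.2 fun i => ?_
  refine (D.differentiableAt_zprod hy.1 i).mul (DifferentiableAt.cexp ?_)
  refine DifferentiableAt.const_mul ?_ _
  refine DifferentiableAt.add_const _ ?_
  exact DifferentiableAt.clog (differentiableAt_apply 0 y)
    (Or.inl (re_pos_of_mem_sector hκ hy.2.1))

/-- A bound for the factor in `|X_i (y)|` that comes from the imaginary parts. -/
def cX : ℝ := Real.exp ((∑ i, |(D.a i).im|) * (Real.pi + 2 * Real.pi * D.ℓ))

/-- The factor |z|^(-Re a_i) in the definition of V cancels the |z|^(Re a_i) coming from exp(a_i log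
z). -/
theorem norm_X_lt {κ R r : ℝ} (hR : 0 < R) (hr : 0 < r) {y : Fin n → ℂ} (hy : y ∈ D.V κ R r)
    (i : Fin n) : ‖D.X y i‖ < r * D.cX * ‖y 0‖ ^ (-D.q) := by
  have hz : 0 < ‖y 0‖ := hR.trans hy.2.2.1
  have hpi := Real.pi_pos
  have hre : (D.a i * D.Lam (y 0)).re ≤ Real.log ‖y 0‖ * (D.a i).re
      + (∑ i, |(D.a i).im|) * (Real.pi + 2 * Real.pi * D.ℓ) := by
    have e1 : (D.a i * D.Lam (y 0)).re = Real.log ‖y 0‖ * (D.a i).re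
        - (D.a i).im * ((y 0).arg + 2 * Real.pi * D.ℓ) := by
      simp [Lam, Complex.log_re, Complex.log_im]
      ring
    have e2 : |(y 0).arg + 2 * Real.pi * D.ℓ| ≤ Real.pi + 2 * Real.pi * D.ℓ := by
      refine (abs_add_le _ _).trans (add_le_add (Complex.abs_arg_le_pi _) ?_)
      rw [abs_of_nonneg (by positivity)]
    have e3 : |(D.a i).im| ≤ ∑ i, |(D.a i).im| :=
      Finset.single_le_sum (f := fun i => |(D.a i).im|) (fun i _ => abs_nonneg _)
        (Finset.mem_univ i)
    have e4 := neg_abs_le ((D.a i).im * ((y 0).arg + 2 * Real.pi * D.ℓ))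
    rw [abs_mul] at e4
    have e5 := mul_le_mul e3 e2 (abs_nonneg _) ((abs_nonneg _).trans e3)
    linarith
  have hexp : ‖Complex.exp (D.a i * D.Lam (y 0))‖ ≤ ‖y 0‖ ^ (D.a i).re * D.cX := by
    rw [Complex.norm_exp, cX, Real.rpow_def_of_pos hz, ← Real.exp_add]
    exact Real.exp_le_exp.2 hre
  rw [X, norm_mul]
  calc _ < r * ‖y 0‖ ^ (-D.q - (D.a i).re) * ‖Complex.exp (D.a i * D.Lam (y 0))‖ :=
        mul_lt_mul_of_pos_right (hy.2.2.2 i) (norm_pos_iff.2 (Complex.exp_ne_zero _))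
    _ ≤ r * ‖y 0‖ ^ (-D.q - (D.a i).re) * (‖y 0‖ ^ (D.a i).re * D.cX) := by gcongr
    _ = _ := by
      rw [Real.rpow_sub hz]
      have : ‖y 0‖ ^ (D.a i).re ≠ 0 := (Real.rpow_pos_of_pos hz _).ne'
      field_simp

/-! ### The inverse of Φ_ℓ as a fixed point -/

/-- The point `X (y)`, multiplied by `exp (-η)`. -/
def pt (y η : Fin n → ℂ) (i : Fin n) : ℂ := D.X y i * Complex.exp (-η i)

/-- The bound on `r` that guarantees that `V` is covered. -/
def r₁ : ℝ := Real.exp (-1) / D.cX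

theorem r₁_pos : 0 < D.r₁ := div_pos (Real.exp_pos _) (Real.exp_pos _)

/-- The constraint ⟨η, m⟩ = 0 is what keeps x^m, and with it Z and the branch, independent of η. -/
theorem Z_pt {y η : Fin n → ℂ} (hy : y ∈ modelSpace D.M) (hy0 : y 0 ≠ 0)
    (hη : pairing η (redM D.M) = 0) :
    D.τ (D.pt y η) = Complex.exp (-(D.Lam (y 0) / D.d)) ∧ D.Z (D.pt y η) = y 0 := by
  have h1 : D.τ (D.pt y η) = Complex.exp (-(D.Lam (y 0) / D.d)) := by
    have : D.τ (D.pt y η) = D.τ (D.X y) * Complex.exp (pairing (fun i => -1 * η i) (redM D.M)) := by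
      simp only [neg_one_mul]
      exact monom_mul_exp _ _ _
    rw [this, pairing_mul, hη, mul_zero, Complex.exp_zero, mul_one, D.τ_X hy]
  refine ⟨h1, ?_⟩
  have hd := D.d_ne_zero
  have : (D.d : ℂ) * -(D.Lam (y 0) / D.d) = -D.Lam (y 0) := by field_simp
  rw [Z, D.p_eq, h1, ← Complex.exp_nat_mul, this, Complex.exp_neg, inv_inv, Lam, Complex.exp_add,
    exp_two_pi_mul_nat, Complex.exp_log hy0, mul_one]

/-- The factor exp(-η_i) is at most e in modulus, and e⁻¹ is built into `r₁`. -/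
theorem pt_mem_U {κ R r : ℝ} (hR : 0 < R) (hr : 0 < r) (hr₁ : r ≤ D.r₁) {y η : Fin n → ℂ}
    (hy : y ∈ D.V κ R r) (hη : pairing η (redM D.M) = 0) (hη1 : ‖η‖ ≤ 1) :
    D.pt y η ∈ D.U κ R := by
  have hz : 0 < ‖y 0‖ := hR.trans hy.2.2.1
  obtain ⟨h1, h2⟩ := D.Z_pt hy.1 (norm_pos_iff.1 hz) hη
  refine ⟨by rw [h2]; exact hy.2.1, by rw [h2]; exact hy.2.2.1, by rw [h1, h2], fun i => ?_⟩
  rw [h2, pt, norm_mul, Complex.norm_exp]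
  have e1 := D.norm_X_lt hR hr hy i
  have e2 : (-η i).re ≤ 1 := by
    refine (Complex.re_le_norm _).trans ?_
    rw [norm_neg]
    exact (norm_le_pi_norm η i).trans hη1
  have hcX : 0 < D.cX := Real.exp_pos _
  have e3 : r * D.cX ≤ Real.exp (-1) := (le_div_iff₀ hcX).1 hr₁
  calc _ ≤ ‖D.X y i‖ * Real.exp 1 := by gcongr
    _ < r * D.cX * ‖y 0‖ ^ (-D.q) * Real.exp 1 := by gcongr
    _ ≤ Real.exp (-1) * ‖y 0‖ ^ (-D.q) * Real.exp 1 := by gcongr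
    _ = _ := by
      rw [mul_right_comm, ← Real.exp_add]
      simp

/-- The map whose fixed point `η` gives the preimage `pt y η` of `y` under `Φ_ℓ`. -/
def T (y η : Fin n → ℂ) (i : Fin n) : ℂ := D.H i (D.pt y η)

/-- The set on which `T y` is a contraction. -/
def ballT : Set (Fin n → ℂ) := {η | pairing η (redM D.M) = 0 ∧ ‖η‖ ≤ 1 / 8}

/-- The iterates of `T y`, starting at `0`. -/
def eta : ℕ → (Fin n → ℂ) → (Fin n → ℂ)
  | 0 => fun _ => 0
  | k + 1 => fun y => D.T y (eta k y)

/-- The limit of the iterates of `T y`. -/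
def etaLim (y : Fin n → ℂ) : Fin n → ℂ := ∑' k, (D.eta (k + 1) y - D.eta k y)

/-- The inverse of `Φ_ℓ`. -/
def S (y : Fin n → ℂ) : Fin n → ℂ := D.pt y (D.etaLim y)

theorem isClosed_ballT : IsClosed D.ballT := by
  refine IsClosed.inter (isClosed_eq ?_ continuous_const)
    (isClosed_le continuous_norm continuous_const)
  unfold pairing
  fun_prop

section Inverse

variable {D} {κ R r : ℝ} (hT : D.Tame κ R) (hr : 0 < r) (hr₁ : r ≤ D.r₁)

include hT hr hr₁ in
theorem norm_T_le {y η : Fin n → ℂ} (hy : y ∈ D.V κ R r)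
    (hη : pairing η (redM D.M) = 0) (hη1 : ‖η‖ ≤ 1) : ‖D.T y η‖ ≤ 1 / 16 :=
  (pi_norm_le_iff_of_nonneg (by norm_num)).2 fun i =>
    hT.H_le i _ (D.pt_mem_U (by linarith [hT.one_le]) hr hr₁ hy hη hη1)

include hT hr hr₁ in
theorem mapsTo_T {y : Fin n → ℂ} (hy : y ∈ D.V κ R r) :
    Set.MapsTo (D.T y) D.ballT D.ballT := fun η hη => by
  have h1 : ‖η‖ ≤ 1 := hη.2.trans (by norm_num)
  exact ⟨hT.pairing_H_redM (D.pt_mem_U (by linarith [hT.one_le]) hr hr₁ hy hη.1 h1),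
    (norm_T_le hT hr hr₁ hy hη.1 h1).trans (by norm_num)⟩

-- The map is bounded by 1/16 where ‖η‖ ≤ 1 and ⟨η, m⟩ = 0. The complex line through η and η'
-- respects this linear constraint and stays in the unit ball for parameters |t| < 1 / (2 ‖η - η'‖).
-- The Schwarz lemma there, between the parameters 0 and 1, even gives the constant 1/4.
include hT hr hr₁ in
theorem norm_T_sub_le {y η η' : Fin n → ℂ} (hy : y ∈ D.V κ R r) (hη : η ∈ D.ballT)
    (hη' : η' ∈ D.ballT) : ‖D.T y η - D.T y η'‖ ≤ 1 / 2 * ‖η - η'‖ := by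
  rcases eq_or_ne η η' with rfl | hne
  · simp
  have hpos : 0 < ‖η - η'‖ := norm_pos_iff.2 (sub_ne_zero.2 hne)
  have hR : 0 < R := by linarith [hT.one_le]
  set c : ℂ → (Fin n → ℂ) := fun t => η' + t • (η - η') with hc
  have hpair : ∀ t, pairing (c t) (redM D.M) = 0 := fun t => by
    have e : pairing (c t) (redM D.M) = pairing η' (redM D.M)
        + t * (pairing η (redM D.M) - pairing η' (redM D.M)) := by
      simp only [hc, pairing, Pi.add_apply, Pi.smul_apply, Pi.sub_apply, smul_eq_mul,
        ← Finset.sum_sub_distrib, Finset.mul_sum, ← Finset.sum_add_distrib]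
      exact Finset.sum_congr rfl fun i _ => by ring
    rw [e, hη.1, hη'.1]
    ring
  have hnorm : ∀ t ∈ ball (0 : ℂ) (1 / 2 / ‖η - η'‖), ‖c t‖ ≤ 1 := fun t ht => by
    rw [mem_ball_zero_iff, lt_div_iff₀ hpos] at ht
    have := norm_add_le η' (t • (η - η'))
    rw [norm_smul] at this
    have := hη'.2
    simp only [hc]
    linarith
  have hmem : ∀ t ∈ ball (0 : ℂ) (1 / 2 / ‖η - η'‖), D.pt y (c t) ∈ D.U κ R := fun t ht =>
    D.pt_mem_U hR hr hr₁ hy (hpair t) (hnorm t ht)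
  have hd : DifferentiableOn ℂ (fun t => D.T y (c t)) (ball 0 (1 / 2 / ‖η - η'‖)) := by
    refine differentiableOn_pi.2 fun i => ?_
    refine (hT.diff_H i).comp ?_ hmem
    have : Differentiable ℂ fun t => D.pt y (c t) := by
      refine differentiable_pi.2 fun i => ?_
      simp only [pt, hc, Pi.add_apply, Pi.smul_apply]
      fun_prop
    exact this.differentiableOn
  have h1 : (1 : ℂ) ∈ ball (0 : ℂ) (1 / 2 / ‖η - η'‖) := by
    rw [mem_ball_zero_iff, lt_div_iff₀ hpos, norm_one, one_mul]
    have := norm_sub_le η η'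
    have := hη.2
    have := hη'.2
    linarith
  have := dist_le_of_bound hd
    (fun t ht => norm_T_le hT hr hr₁ hy (hpair t) (hnorm t ht)) h1
  simp only [hc, one_smul, zero_smul, add_zero, add_sub_cancel, sub_zero, norm_one, mul_one]
    at this
  refine this.trans ?_
  rw [div_div_eq_mul_div]
  linarith

include hT hr hr₁ in
theorem eta_mem {y : Fin n → ℂ} (hy : y ∈ D.V κ R r) (k : ℕ) : D.eta k y ∈ D.ballT := by
  induction k with
  | zero => exact ⟨by simp [eta, pairing], by simp [eta]⟩
  | succ k ih => exact mapsTo_T hT hr hr₁ hy ih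

include hT hr hr₁ in
theorem norm_eta_sub_le {y : Fin n → ℂ} (hy : y ∈ D.V κ R r) (k : ℕ) :
    ‖D.eta (k + 1) y - D.eta k y‖ ≤ 1 / 8 * (1 / 2) ^ k := by
  induction k with
  | zero => simpa [eta] using (eta_mem hT hr hr₁ hy 1).2
  | succ k ih =>
    have := norm_T_sub_le hT hr hr₁ hy (eta_mem hT hr hr₁ hy (k + 1)) (eta_mem hT hr hr₁ hy k)
    rw [pow_succ]
    change ‖D.T y (D.eta (k + 1) y) - D.T y (D.eta k y)‖ ≤ _
    linarith

theorem summable_eta_bound : Summable fun k : ℕ => (1 / 8 : ℝ) * (1 / 2) ^ k :=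
  summable_geometric_two.mul_left _

include hT hr hr₁ in
theorem tendsto_eta {y : Fin n → ℂ} (hy : y ∈ D.V κ R r) :
    Tendsto (fun k => D.eta k y) atTop (𝓝 (D.etaLim y)) := by
  have h1 : Summable fun k => D.eta (k + 1) y - D.eta k y :=
    Summable.of_norm_bounded summable_eta_bound (norm_eta_sub_le hT hr hr₁ hy)
  have h2 := h1.hasSum.tendsto_sum_nat
  simp only [Finset.sum_range_sub (fun k => D.eta k y)] at h2
  have h3 : D.eta 0 y = 0 := rfl
  simp only [h3, sub_zero] at h2
  exact h2

include hT hr hr₁ in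
theorem etaLim_mem {y : Fin n → ℂ} (hy : y ∈ D.V κ R r) : D.etaLim y ∈ D.ballT :=
  D.isClosed_ballT.mem_of_tendsto (tendsto_eta hT hr hr₁ hy)
    (Eventually.of_forall (eta_mem hT hr hr₁ hy))

include hT hr hr₁ in
theorem T_etaLim {y : Fin n → ℂ} (hy : y ∈ D.V κ R r) : D.T y (D.etaLim y) = D.etaLim y := by
  have h1 := tendsto_eta hT hr hr₁ hy
  refine tendsto_nhds_unique ?_ ((tendsto_add_atTop_iff_nat 1).2 h1)
  have h2 : Tendsto (fun k => 1 / 2 * ‖D.eta k y - D.etaLim y‖) atTop (𝓝 0) := by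
    have := ((h1.sub_const (D.etaLim y)).norm).const_mul (1 / 2)
    simpa using this
  have h3 : Tendsto (fun k => D.eta (k + 1) y - D.T y (D.etaLim y)) atTop (𝓝 0) :=
    squeeze_zero_norm (fun k => norm_T_sub_le hT hr hr₁ hy (eta_mem hT hr hr₁ hy k)
      (etaLim_mem hT hr hr₁ hy)) h2
  have := h3.add_const (D.T y (D.etaLim y))
  simpa using this

theorem differentiableOn_pt (hκ : 0 < κ) {η : (Fin n → ℂ) → (Fin n → ℂ)}
    (hη : DifferentiableOn ℂ η (D.V κ R r)) :
    DifferentiableOn ℂ (fun y => D.pt y (η y)) (D.V κ R r) := by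
  intro y hy
  refine differentiableWithinAt_pi.2 fun i => ?_
  refine DifferentiableWithinAt.mul ?_ (DifferentiableWithinAt.cexp ?_)
  · exact (differentiableAt_pi.1 (D.differentiableAt_X hκ hy) i).differentiableWithinAt
  · exact (differentiableWithinAt_pi.1 (hη y hy) i).neg

include hT hr hr₁ in
theorem differentiableOn_eta (k : ℕ) : DifferentiableOn ℂ (D.eta k) (D.V κ R r) := by
  induction k with
  | zero => exact differentiableOn_const 0
  | succ k ih =>
    refine differentiableOn_pi.2 fun i => ?_
    refine (hT.diff_H i).comp (differentiableOn_pt hT.κ_pos ih) fun y hy => ?_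
    have h := eta_mem hT hr hr₁ hy k
    exact D.pt_mem_U (by linarith [hT.one_le]) hr hr₁ hy h.1 (h.2.trans (by norm_num))

-- The iterates are holomorphic in y, and their increments are bounded by a geometric series
-- independent of y, so the fixed point is holomorphic in y.
include hT hr hr₁ in
theorem differentiableOn_S : DifferentiableOn ℂ D.S (D.V κ R r) :=
  differentiableOn_pt hT.κ_pos <|
    differentiableOn_tsum_of_bound (D.isOpen_V (by linarith [hT.one_le])) summable_eta_bound
      (fun k => (differentiableOn_eta hT hr hr₁ (k + 1)).sub (differentiableOn_eta hT hr hr₁ k))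
      fun k _ hy => norm_eta_sub_le hT hr hr₁ hy k

include hT hr hr₁ in
theorem S_mem {y : Fin n → ℂ} (hy : y ∈ D.V κ R r) : D.S y ∈ D.U κ R := by
  have h := etaLim_mem hT hr hr₁ hy
  exact D.pt_mem_U (by linarith [hT.one_le]) hr hr₁ hy h.1 (h.2.trans (by norm_num))

include hT hr hr₁ in
theorem Z_S {y : Fin n → ℂ} (hy : y ∈ D.V κ R r) : D.Z (D.S y) = y 0 :=
  (D.Z_pt hy.1 (norm_pos_iff.1 (by linarith [hT.one_le, hy.2.2.1]))
    (etaLim_mem hT hr hr₁ hy).1).2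

include hT hr hr₁ in
theorem Ph_S {y : Fin n → ℂ} (hy : y ∈ D.V κ R r) : D.Ph (D.S y) = y := by
  refine (hT.Ph_eq_iff (S_mem hT hr hr₁ hy) hy.1).2 ⟨Z_S hT hr hr₁ hy, fun i => ?_⟩
  have h := congrFun (T_etaLim hT hr hr₁ hy) i
  rw [T] at h
  rw [S, h, pt, mul_assoc, ← Complex.exp_add]
  simp

-- For any preimage x, the vector H(x) is a fixed point of `T y` and lies in `ballT` because |H_i| ≤
-- 1/16. A contraction has only one fixed point there.
include hT hr hr₁ in
theorem eq_S_of_Ph_eq {x y : Fin n → ℂ} (hy : y ∈ D.V κ R r) (hx : x ∈ D.U κ R)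
    (h : D.Ph x = y) : x = D.S y := by
  obtain ⟨-, h2⟩ := (hT.Ph_eq_iff hx hy.1).1 h
  set η : Fin n → ℂ := fun i => D.H i x with hη
  have hxpt : x = D.pt y η := by
    funext i
    rw [pt, ← h2 i, mul_assoc, ← Complex.exp_add]
    simp [hη]
  have hmem : η ∈ D.ballT := by
    refine ⟨hT.pairing_H_redM hx, (pi_norm_le_iff_of_nonneg (by norm_num)).2 fun i => ?_⟩
    exact (hT.H_le i x hx).trans (by norm_num)
  have hfix : D.T y η = η := by
    funext i
    rw [T, ← hxpt]
  have h3 := norm_T_sub_le hT hr hr₁ hy hmem (etaLim_mem hT hr hr₁ hy)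
  rw [hfix, T_etaLim hT hr hr₁ hy] at h3
  have h4 : ‖η - D.etaLim y‖ = 0 := le_antisymm (by linarith) (norm_nonneg _)
  rw [hxpt, S, sub_eq_zero.1 (norm_eq_zero.1 h4)]

end Inverse

end Setup

end FatouCoord

end

/-! ### Expansions in x and log Z -/

noncomputable section

namespace FatouCoord

open Filter Topology Metric Asymptotics

theorem norm_monom_le {n : ℕ} (x : Fin n → ℂ) (I : Fin n → ℕ) :
    ‖monom x I‖ ≤ ‖x‖ ^ ∑ i, I i := by
  rw [monom, norm_prod, ← Finset.prod_pow_eq_pow_sum]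
  refine Finset.prod_le_prod (fun i _ => norm_nonneg _) fun i _ => ?_
  rw [norm_pow]
  gcongr
  exact norm_le_pi_norm x i

namespace Setup

variable {n : ℕ} [NeZero n] (D : Setup n)

/-- The filter of neighbourhoods of the origin in the domain of `log Z`. -/
def nhdsU : Filter (Fin n → ℂ) := 𝓝[D.U D.κ₀ 1] 0

/-- The logarithm of `1 / x ^ M`. -/
def t (x : Fin n → ℂ) : ℂ := Complex.log (D.Z x)

/-- A majorant of the logarithm. -/
def w (x : Fin n → ℂ) : ℝ := 1 + ‖D.t x‖

theorem one_le_w (x : Fin n → ℂ) : 1 ≤ D.w x := by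
  rw [w]
  linarith [norm_nonneg (D.t x)]

/-- Functions that are `O (‖x‖ ^ N)` up to powers of the logarithm. -/
def Err (N : ℕ) : Submodule ℂ ((Fin n → ℂ) → ℂ) where
  carrier := {g | ∃ K : ℕ, g =O[D.nhdsU] fun x => ‖x‖ ^ N * D.w x ^ K}
  zero_mem' := ⟨0, isBigO_zero _ _⟩
  add_mem' := by
    have hmono : ∀ {K L : ℕ}, K ≤ L →
        (fun x => ‖x‖ ^ N * D.w x ^ K) =O[D.nhdsU] fun x => ‖x‖ ^ N * D.w x ^ L := fun h =>
      IsBigO.of_bound 1 <| Eventually.of_forall fun x => by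
        have hw := D.one_le_w x
        have : 0 ≤ D.w x := by linarith
        rw [Real.norm_of_nonneg (by positivity), Real.norm_of_nonneg (by positivity), one_mul]
        gcongr
    rintro g g' ⟨K, hK⟩ ⟨L, hL⟩
    exact ⟨max K L, (hK.trans (hmono (le_max_left _ _))).add (hL.trans (hmono (le_max_right _ _)))⟩
  smul_mem' := by
    rintro c g ⟨K, hK⟩
    exact ⟨K, hK.const_mul_left c⟩

/-- The function `x ^ I (log Z) ^ k`. -/
def gen (I : Fin n → ℕ) (k : ℕ) (x : Fin n → ℂ) : ℂ := monom x I * D.t x ^ k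

theorem eventually_norm_le_one : ∀ᶠ x in D.nhdsU, ‖x‖ ≤ 1 := by
  refine mem_nhdsWithin_of_mem_nhds ?_
  filter_upwards [ball_mem_nhds (0 : Fin n → ℂ) one_pos] with x hx
  exact (mem_ball_zero_iff.1 hx).le

theorem gen_mem_Err {N : ℕ} {I : Fin n → ℕ} (hI : N ≤ ∑ i, I i) (k : ℕ) :
    D.gen I k ∈ D.Err N := by
  refine ⟨k, IsBigO.of_bound 1 ?_⟩
  filter_upwards [D.eventually_norm_le_one] with x hx
  have hw := D.one_le_w x
  rw [Real.norm_of_nonneg (by positivity), one_mul, gen, norm_mul, norm_pow]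
  gcongr
  · exact (norm_monom_le x I).trans (pow_le_pow_of_le_one (norm_nonneg _) hx hI)
  · rw [w]
    linarith

theorem Err_mul {N N' : ℕ} {g g' : (Fin n → ℂ) → ℂ} (hg : g ∈ D.Err N) (hg' : g' ∈ D.Err N') :
    g * g' ∈ D.Err (N + N') := by
  obtain ⟨K, hK⟩ := hg
  obtain ⟨L, hL⟩ := hg'
  refine ⟨K + L, (hK.mul hL).congr_right fun x => ?_⟩
  ring

theorem Err_anti {N N' : ℕ} (h : N ≤ N') : D.Err N' ≤ D.Err N := by
  rintro g ⟨K, hK⟩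
  refine ⟨K, hK.trans (IsBigO.of_bound 1 ?_)⟩
  filter_upwards [D.eventually_norm_le_one] with x hx
  have hw := D.one_le_w x
  rw [Real.norm_of_nonneg (by positivity), Real.norm_of_nonneg (by positivity), one_mul]
  gcongr ?_ * _
  exact pow_le_pow_of_le_one (norm_nonneg _) hx h

/-- Functions of order at least `q` in `x`: polynomials in `x` and `log Z`, modulo functions that
are almost `O (‖x‖ ^ N)`. -/
def Sq (N q : ℕ) : Submodule ℂ ((Fin n → ℂ) → ℂ) :=
  Submodule.span ℂ ({g | ∃ I k, q ≤ ∑ i, I i ∧ g = D.gen I k} ∪ D.Err N)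

variable {D} {N q q' : ℕ}

theorem gen_mem_Sq {I : Fin n → ℕ} (hI : q ≤ ∑ i, I i) (k : ℕ) : D.gen I k ∈ D.Sq N q :=
  Submodule.subset_span (Or.inl ⟨I, k, hI, rfl⟩)

theorem Err_le_Sq : D.Err N ≤ D.Sq N q := fun _ hg => Submodule.subset_span (Or.inr hg)

theorem Sq_anti (h : q ≤ q') : D.Sq N q' ≤ D.Sq N q := by
  refine Submodule.span_le.2 ?_
  rintro g (⟨I, k, hI, rfl⟩ | hg)
  · exact gen_mem_Sq (h.trans hI) k
  · exact Err_le_Sq hg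

theorem Sq_le_Err : D.Sq N N ≤ D.Err N := by
  refine Submodule.span_le.2 ?_
  rintro g (⟨I, k, hI, rfl⟩ | hg)
  · exact D.gen_mem_Err hI k
  · exact hg

/-- Membership depends only on the germ along `nhdsU`, so identities for f that hold near the origin
inside the domain are enough. -/
theorem Sq_congr {g g' : (Fin n → ℂ) → ℂ} (h : g =ᶠ[D.nhdsU] g') (hg' : g' ∈ D.Sq N q) :
    g ∈ D.Sq N q := by
  have h1 : g - g' ∈ D.Err N := by
    refine ⟨0, IsBigO.of_bound 0 ?_⟩
    filter_upwards [h] with x hx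
    simp [hx]
  have := add_mem (Err_le_Sq (q := q) h1) hg'
  rwa [sub_add_cancel] at this

theorem gen_mul_gen (I J : Fin n → ℕ) (k l : ℕ) :
    D.gen I k * D.gen J l = D.gen (I + J) (k + l) := by
  funext x
  simp only [gen, monom, Pi.mul_apply, Pi.add_apply, pow_add, Finset.prod_mul_distrib]
  ring

theorem Sq_mul {g g' : (Fin n → ℂ) → ℂ} (hg : g ∈ D.Sq N q) (hg' : g' ∈ D.Sq N q') :
    g * g' ∈ D.Sq N (q + q') := by
  have h := Submodule.mul_mem_mul hg hg'
  rw [Sq, Sq, Submodule.span_mul_span] at h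
  refine Submodule.span_le.2 ?_ h
  rintro _ ⟨g, hg, g', hg', rfl⟩
  rcases hg with ⟨I, k, hI, rfl⟩ | hg <;> rcases hg' with ⟨J, l, hJ, rfl⟩ | hg'
  · simp only [gen_mul_gen]
    refine gen_mem_Sq ?_ _
    simp only [Pi.add_apply, Finset.sum_add_distrib]
    exact add_le_add hI hJ
  · refine Err_le_Sq ?_
    have := D.Err_mul (D.gen_mem_Err (Nat.zero_le (∑ i, I i)) k) hg'
    rwa [zero_add] at this
  · refine Err_le_Sq ?_
    exact D.Err_mul hg (D.gen_mem_Err (Nat.zero_le (∑ i, J i)) l)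
  · exact Err_le_Sq (D.Err_anti (Nat.le_add_right _ _) (D.Err_mul hg hg'))

theorem const_mem_Sq (c : ℂ) : (fun _ => c) ∈ D.Sq N 0 := by
  have h : (fun _ : Fin n → ℂ => c) = c • D.gen (fun _ => 0) 0 := by
    funext x
    simp [gen, monom]
  rw [h]
  exact Submodule.smul_mem _ _ (gen_mem_Sq (Nat.zero_le _) _)

theorem t_pow_mem_Sq (k : ℕ) : (fun x => D.t x ^ k) ∈ D.Sq N 0 := by
  have h : (fun x => D.t x ^ k) = D.gen (fun _ => 0) k := by
    funext x
    simp [gen, monom]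
  rw [h]
  exact gen_mem_Sq (Nat.zero_le _) _

theorem monom_mem_Sq (I : Fin n → ℕ) : (fun x => monom x I) ∈ D.Sq N (∑ i, I i) := by
  have h : (fun x => monom x I) = D.gen I 0 := by
    funext x
    simp [gen]
  rw [h]
  exact gen_mem_Sq le_rfl _

theorem proj_mem_Sq (i : Fin n) : (fun x => x i) ∈ D.Sq N 1 := by
  have h := monom_mem_Sq (D := D) (N := N) (Pi.single i 1)
  rw [Finset.sum_pi_single'] at h
  simp only [Finset.mem_univ, if_true] at h
  have e : (fun x : Fin n → ℂ => monom x (Pi.single i 1)) = fun x => x i := by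
    funext x
    rw [monom, Finset.prod_eq_single i (by intro j _ hj; simp [hj]) (by simp)]
    simp
  rwa [e] at h

theorem prod_proj_mem_Sq {k : ℕ} (r : Fin k → Fin n) :
    (fun x => ∏ j, x (r j)) ∈ D.Sq N k := by
  induction k with
  | zero => simpa using const_mem_Sq 1
  | succ k ih =>
    have := Sq_mul (ih fun j => r j.castSucc) (proj_mem_Sq (D := D) (N := N) (r (Fin.last k)))
    convert this using 1
    funext x
    rw [Fin.prod_univ_castSucc]
    rfl

theorem multilinear_mem_Sq {k : ℕ}
    (c : ContinuousMultilinearMap ℂ (fun _ : Fin k => Fin n → ℂ) ℂ) :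
    (fun x => c fun _ => x) ∈ D.Sq N k := by
  have h : (fun x => c fun _ => x) = ∑ r : Fin k → Fin n,
      c (fun j => Pi.single (r j) 1) • fun x : Fin n → ℂ => ∏ j, x (r j) := by
    funext x
    have hx : x = ∑ i, x i • (Pi.single i 1 : Fin n → ℂ) := by
      simpa using (pi_eq_sum_univ' x)
    conv_lhs => rw [hx]
    rw [ContinuousMultilinearMap.map_sum]
    simp only [ContinuousMultilinearMap.map_smul_univ, Finset.sum_apply, Pi.smul_apply,
      smul_eq_mul, mul_comm]
  rw [h]
  exact Submodule.sum_mem _ fun r _ => Submodule.smul_mem _ _ (prod_proj_mem_Sq r)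

/-- The Taylor remainder of order N goes into `Err N`. The Taylor polynomial has no constant term,
and its homogeneous parts expand into monomials. -/
theorem analyticAt_mem_Sq_one {g : (Fin n → ℂ) → ℂ} (hg : AnalyticAt ℂ g 0) (h0 : g 0 = 0) :
    g ∈ D.Sq N 1 := by
  obtain ⟨c, hc⟩ := hg
  have h1 : (fun x => g x - c.partialSum N x) ∈ D.Err N := by
    refine ⟨0, ?_⟩
    have := hc.isBigO_sub_partialSum_pow N
    simp only [zero_add, pow_zero, mul_one] at this ⊢
    exact this.mono nhdsWithin_le_nhds
  have h2 : (fun x => c.partialSum N x) ∈ D.Sq N 1 := by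
    have e : (fun x => c.partialSum N x) = ∑ k ∈ Finset.range N, fun x => c k fun _ => x := by
      funext x
      simp [FormalMultilinearSeries.partialSum]
    rw [e]
    refine Submodule.sum_mem _ fun k _ => ?_
    rcases k with _ | k
    · have : (fun x => c 0 fun _ => x) = (0 : (Fin n → ℂ) → ℂ) := by
        funext x
        simpa [h0] using hc.coeff_zero fun _ => x
      rw [this]
      exact zero_mem _
    · exact Sq_anti (Nat.le_add_left 1 k) (multilinear_mem_Sq (c (k + 1)))
  have := add_mem (Err_le_Sq (q := 1) h1) h2
  convert this using 1
  funext x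
  simp

theorem analyticAt_sub_mem_Sq {g : (Fin n → ℂ) → ℂ} (hg : AnalyticAt ℂ g 0) {c : ℂ}
    (h0 : g 0 = c) : (fun x => g x - c) ∈ D.Sq N 1 :=
  analyticAt_mem_Sq_one (hg.sub analyticAt_const) (by simp [h0])

theorem analyticAt_mem_Sq {g : (Fin n → ℂ) → ℂ} (hg : AnalyticAt ℂ g 0) : g ∈ D.Sq N 0 := by
  have := add_mem (Sq_anti (Nat.zero_le 1) (analyticAt_sub_mem_Sq (D := D) (N := N) hg rfl))
    (const_mem_Sq (g 0))
  convert this using 1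
  funext x
  simp

variable (D)

/-! ### The Abel equation, order by order -/

/-- The increment of `Z u` under `f`. -/
def Dz : ((Fin n → ℂ) → ℂ) →ₗ[ℂ] ((Fin n → ℂ) → ℂ) where
  toFun u x := D.Z (D.f x) * u (D.f x) - D.Z x * u x
  map_add' u v := by
    funext x
    simp only [Pi.add_apply]
    ring
  map_smul' c u := by
    funext x
    simp only [Pi.smul_apply, smul_eq_mul, RingHom.id_apply]
    ring

/-- The function with `(t + p K) ^ k = t ^ k + p J_k`. -/
def J : ℕ → (Fin n → ℂ) → ℂ
  | 0 => 0
  | k + 1 => fun x => (D.t x + D.p x * (1 + D.what x)) * J k x + (1 + D.what x) * D.t x ^ k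

theorem J_spec (k : ℕ) (x : Fin n → ℂ) :
    (D.t x + D.p x * (1 + D.what x)) ^ k = D.t x ^ k + D.p x * D.J k x := by
  induction k with
  | zero => simp [J]
  | succ k ih =>
    rw [pow_succ, ih, J]
    ring

/-- The hypothesis is the conclusion of `J_sub_mem`, whose induction uses this lemma at the
preceding k. -/
theorem J_mem (k : ℕ) (h : (fun x => D.J k x - k * D.t x ^ (k - 1)) ∈ D.Sq N 1) :
    D.J k ∈ D.Sq N 0 := by
  have := add_mem (Sq_anti (Nat.zero_le 1) h)
    (Submodule.smul_mem _ (k : ℂ) (t_pow_mem_Sq (D := D) (N := N) (k - 1)))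
  convert this using 1
  funext x
  simp

/-- Since p K = p + higher order, J_k is the derivative k t^(k-1) up to order 1 in x. For k = 0 the
truncated exponent is harmless, as its coefficient vanishes. -/
theorem J_sub_mem (k : ℕ) : (fun x => D.J k x - k * D.t x ^ (k - 1)) ∈ D.Sq N 1 := by
  induction k with
  | zero =>
    convert (D.Sq N 1).zero_mem using 1
    funext x
    simp [J]
  | succ k ih =>
    have hp : D.p ∈ D.Sq N 1 := analyticAt_mem_Sq_one D.analyticAt_p D.p_zero
    have hK : (fun x => 1 + D.what x) ∈ D.Sq N 0 :=
      analyticAt_mem_Sq (analyticAt_const.add D.analyticAt_what)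
    have hw : D.what ∈ D.Sq N 1 := analyticAt_mem_Sq_one D.analyticAt_what D.what_zero
    have h1 := Sq_mul (t_pow_mem_Sq (D := D) (N := N) 1) ih
    have h2 := Sq_mul (Sq_mul hp hK) (D.J_mem k ih)
    have h3 := Sq_mul hw (t_pow_mem_Sq (D := D) (N := N) k)
    convert add_mem (add_mem h1 h2) h3 using 1
    funext x
    simp only [J, Pi.add_apply, Pi.mul_apply, pow_one, Nat.add_sub_cancel]
    rcases k with _ | k
    · simp
      ring
    · simp only [Nat.add_sub_cancel]
      push_cast
      ring

theorem eventually_nhdsU : ∀ᶠ x in D.nhdsU, x ∈ D.U D.κ₀ 1 ∧ D.Near x :=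
  (eventually_mem_nhdsWithin).and (mem_nhdsWithin_of_mem_nhds D.eventually_near)

/-- The leading part of the increment of `Z x ^ I (log Z) ^ k`. -/
theorem Dz_gen_sub_mem (I : Fin n → ℕ) (k : ℕ) :
    D.Dz (D.gen I k) - ((1 + pairing D.a I) • D.gen I k + (k : ℂ) • D.gen I (k - 1))
      ∈ D.Sq N (∑ i, I i + 1) := by
  set c : ℂ := 1 + pairing D.a I with hc
  set r : (Fin n → ℂ) → ℂ := fun x => c + (D.what x + pairing (fun i => D.lhat i x) I) with hr
  set B : (Fin n → ℂ) → ℂ := fun x => r x * expQuot (D.p x * r x) with hB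
  have hra : AnalyticAt ℂ r 0 := analyticAt_const.add
    (D.analyticAt_what.add (analyticAt_pairing D.analyticAt_lhat I))
  have hr0 : r 0 = c := by simp [hr, D.what_zero, D.lhat_zero, pairing]
  have hBa : AnalyticAt ℂ B 0 := by
    refine hra.mul (AnalyticAt.fun_comp ?_ (D.analyticAt_p.mul hra))
    simpa [D.p_zero] using analyticAt_expQuot
  have hB0 : B 0 = c := by simp [hB, hr0, D.p_zero, expQuot_zero]
  have hp : D.p ∈ D.Sq N 1 := analyticAt_mem_Sq_one D.analyticAt_p D.p_zero
  have hJ1 := D.J_sub_mem (N := N) k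
  have hJ0 := D.J_mem k hJ1
  have h1 := Sq_mul (analyticAt_sub_mem_Sq (D := D) (N := N) hBa hB0)
    (t_pow_mem_Sq (D := D) (N := N) k)
  have h2 := Sq_mul (Sq_mul hp (analyticAt_mem_Sq (D := D) (N := N) hBa)) hJ0
  -- As Z p = 1, the increment equals x^I (B t^k + J_k + p B J_k). Subtracting the leading part
  -- leaves x^I times (B - c) t^k + (J_k - k t^(k-1)) + p B J_k, a sum of three terms of order at
  -- least 1.
  refine Sq_congr ?_ (Sq_mul (monom_mem_Sq (D := D) (N := N) I) (add_mem (add_mem h1 hJ1) h2))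
  filter_upwards [D.eventually_nhdsU] with x hx
  obtain ⟨hxU, hn⟩ := hx
  have hp0 := D.p_ne_zero_of_mem_U D.κ₀_pos hxU
  have hre := re_pos_of_mem_sector D.κ₀_pos hxU.1
  have e1 : D.Dz (D.gen I k) x = D.Z (D.f x) * (monom (D.f x) I * D.t (D.f x) ^ k)
      - D.Z x * (monom x I * D.t x ^ k) := rfl
  have e2 : D.t (D.f x) = D.t x + D.p x * (1 + D.what x) := hn.log_Z_f _ hre
  have e3 : D.Z (D.f x) * monom (D.f x) I = D.Z x * monom x I * (1 + D.p x * B x) := by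
    have : 1 + D.p x * B x = Complex.exp (D.p x * r x) := by
      rw [exp_eq_expQuot, hB]
      ring
    rw [this, hn.Z_f, hn.monom_f]
    have : D.p x * r x = D.p x * (1 + D.what x)
        + D.p x * (pairing D.a I + pairing (fun i => D.lhat i x) I) := by
      rw [hr, hc]
      ring
    rw [this, Complex.exp_add]
    ring
  have e4 : D.Z x * D.p x = 1 := inv_mul_cancel₀ hp0
  simp only [Pi.sub_apply, Pi.add_apply, Pi.mul_apply, Pi.smul_apply, smul_eq_mul]
  rw [e1, ← mul_assoc, e3, e2, D.J_spec, gen, gen]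
  linear_combination (monom x I * (D.J k x + B x * D.t x ^ k + D.p x * B x * D.J k x)) * e4

/-- The polynomials in `x` and `log Z` without terms of order `0` in `x`. -/
def Pol : Submodule ℂ ((Fin n → ℂ) → ℂ) :=
  Submodule.span ℂ {g | ∃ I k, 1 ≤ ∑ i, I i ∧ g = D.gen I k}

variable {D} in
theorem gen_mem_Pol {I : Fin n → ℕ} (hI : 1 ≤ ∑ i, I i) (k : ℕ) : D.gen I k ∈ D.Pol :=
  Submodule.subset_span ⟨I, k, hI, rfl⟩

/-- To leading order `Dz` acts on the span of x^I t^k for fixed I as 1 + ⟨a, I⟩ + d/dt, which is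
surjective on polynomials in t. -/
theorem exists_Dz_gen {I : Fin n → ℕ} (hI : 1 ≤ ∑ i, I i) (k : ℕ) :
    ∃ u ∈ D.Pol, D.Dz u - D.gen I k ∈ D.Sq N (∑ i, I i + 1) := by
  by_cases hc : 1 + pairing D.a I = 0
  -- Resonance: only d/dt is left, so the solution is an antiderivative and has one more power of
  -- log Z.
  · refine ⟨((k : ℂ) + 1)⁻¹ • D.gen I (k + 1), Submodule.smul_mem _ _ (gen_mem_Pol hI _), ?_⟩
    have hk : (k : ℂ) + 1 ≠ 0 := Nat.cast_add_one_ne_zero k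
    have := Submodule.smul_mem _ ((k : ℂ) + 1)⁻¹ (D.Dz_gen_sub_mem (N := N) I (k + 1))
    rw [hc, zero_smul, zero_add, smul_sub, smul_smul] at this
    push_cast at this
    rwa [inv_mul_cancel₀ hk, one_smul, ← map_smul] at this
  · induction k with
    | zero =>
      refine ⟨(1 + pairing D.a I)⁻¹ • D.gen I 0, Submodule.smul_mem _ _ (gen_mem_Pol hI _), ?_⟩
      have := Submodule.smul_mem _ (1 + pairing D.a I)⁻¹ (D.Dz_gen_sub_mem (N := N) I 0)
      rw [Nat.cast_zero, zero_smul, add_zero, smul_sub, smul_smul] at this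
      rwa [inv_mul_cancel₀ hc, one_smul, ← map_smul] at this
    | succ k ih =>
      obtain ⟨u, hu, hmem⟩ := ih
      -- Without resonance, x^I t^(k+1) produces an unwanted (k + 1) x^I t^k, which the solution u
      -- for k removes.
      refine ⟨(1 + pairing D.a I)⁻¹ • (D.gen I (k + 1) - ((k : ℂ) + 1) • u),
        Submodule.smul_mem _ _ (sub_mem (gen_mem_Pol hI _) (Submodule.smul_mem _ _ hu)), ?_⟩
      have h1 := sub_mem (D.Dz_gen_sub_mem (N := N) I (k + 1))
        (Submodule.smul_mem _ ((k : ℂ) + 1) hmem)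
      have h2 := Submodule.smul_mem _ (1 + pairing D.a I)⁻¹ h1
      convert h2 using 1
      rw [map_smul, map_sub, map_smul]
      funext x
      simp only [Pi.sub_apply, Pi.smul_apply, Pi.add_apply, smul_eq_mul, Nat.add_sub_cancel]
      push_cast
      field_simp
      ring

theorem exists_Dz_sub_mem (hq : 1 ≤ q) {g : (Fin n → ℂ) → ℂ} (hg : g ∈ D.Sq N q) :
    ∃ u ∈ D.Pol, D.Dz u - g ∈ D.Sq N (q + 1) := by
  induction hg using Submodule.span_induction with
  | mem g hg =>
    rcases hg with ⟨I, k, hI, rfl⟩ | hg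
    · obtain ⟨u, hu, h⟩ := D.exists_Dz_gen (N := N) (hq.trans hI) k
      exact ⟨u, hu, Sq_anti (by omega) h⟩
    · refine ⟨0, zero_mem _, ?_⟩
      rw [map_zero, zero_sub]
      exact neg_mem (Err_le_Sq hg)
  | zero => exact ⟨0, zero_mem _, by simp⟩
  | add g g' _ _ ih ih' =>
    obtain ⟨u, hu, h⟩ := ih
    obtain ⟨u', hu', h'⟩ := ih'
    refine ⟨u + u', add_mem hu hu', ?_⟩
    rw [map_add, add_sub_add_comm]
    exact add_mem h h'
  | smul c g _ ih =>
    obtain ⟨u, hu, h⟩ := ih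
    refine ⟨c • u, Submodule.smul_mem _ _ hu, ?_⟩
    rw [map_smul, ← smul_sub]
    exact Submodule.smul_mem _ _ h

theorem exists_h_add_Dz_mem (q : ℕ) : ∃ u ∈ D.Pol, D.h + D.Dz u ∈ D.Sq N (q + 1) := by
  induction q with
  | zero =>
    refine ⟨0, zero_mem _, ?_⟩
    rw [map_zero, add_zero]
    exact analyticAt_mem_Sq_one D.analyticAt_h D.h_zero
  | succ q ih =>
    obtain ⟨u, hu, h⟩ := ih
    obtain ⟨v, hv, h'⟩ := D.exists_Dz_sub_mem (Nat.le_add_left 1 q) h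
    refine ⟨u - v, sub_mem hu hv, ?_⟩
    have := neg_mem h'
    rw [map_sub]
    convert this using 1
    abel

/-- An approximate solution of the equation for the Fatou coordinate. -/
theorem exists_h_add_Dz_mem_Err (N : ℕ) : ∃ u ∈ D.Pol, D.h + D.Dz u ∈ D.Err N := by
  obtain ⟨u, hu, h⟩ := D.exists_h_add_Dz_mem (N := N) N
  exact ⟨u, hu, Sq_le_Err (Sq_anti (Nat.le_add_right N 1) h)⟩

theorem Pol_le_Err : D.Pol ≤ D.Err 1 := by
  refine Submodule.span_le.2 ?_
  rintro g ⟨I, k, hI, rfl⟩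
  exact D.gen_mem_Err hI k

theorem differentiableAt_Z {κ R : ℝ} (hκ : 0 < κ) {x : Fin n → ℂ} (hx : x ∈ D.U κ R) :
    DifferentiableAt ℂ D.Z x :=
  (differentiable_monom D.M x).inv (D.p_ne_zero_of_mem_U hκ hx)

theorem differentiableOn_of_mem_Pol {κ R : ℝ} (hκ : 0 < κ) {u : (Fin n → ℂ) → ℂ}
    (hu : u ∈ D.Pol) : DifferentiableOn ℂ u (D.U κ R) := by
  induction hu using Submodule.span_induction with
  | mem g hg =>
    obtain ⟨I, k, -, rfl⟩ := hg
    intro x hx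
    have h1 := (D.differentiableAt_Z hκ hx).clog (Or.inl (re_pos_of_mem_sector hκ hx.1))
    exact ((differentiable_monom I x).mul (h1.pow k)).differentiableWithinAt
  | zero => exact differentiableOn_const 0
  | add g g' _ _ ih ih' => exact ih.add ih'
  | smul c g _ ih => exact ih.const_smul c

/-- Functions of `Err N` decay like a power of `Z` that is as close to `q N` as desired. -/
theorem exists_norm_le_of_mem_Err {g : (Fin n → ℂ) → ℂ} (hg : g ∈ D.Err N) {σ : ℝ}
    (hσ : 0 < σ) : ∃ C ≥ (0 : ℝ), ∃ R₀ ≥ (1 : ℝ), ∀ R, R₀ ≤ R → ∀ x ∈ D.U D.κ₀ R,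
      ‖g x‖ ≤ C * ‖D.Z x‖ ^ (-(D.q * N) + σ) := by
  obtain ⟨K, hK⟩ := hg
  obtain ⟨c, hc, hb⟩ := hK.exists_nonneg
  have hb' := eventually_nhdsWithin_iff.1 hb.bound
  obtain ⟨R₀, hR₀, h⟩ := D.exists_forall_mem_U hb'
  -- Here K + 1 replaces K so that the quotient also makes sense for K = 0.
  set s : ℝ := σ / (K + 1) with hs
  have hs0 : 0 < s := by positivity
  have hpi := Real.pi_pos
  refine ⟨c * (1 + Real.pi + 1 / s) ^ (K + 1), by positivity, R₀, hR₀, fun R hR x hx => ?_⟩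
  have h1 := h D.κ₀ R hR x hx (D.U_mono le_rfl D.κ₀_pos (hR₀.trans hR) hx)
  have hZ1 : 1 ≤ ‖D.Z x‖ := (hR₀.trans hR).trans hx.2.1.le
  have hZ0 : 0 < ‖D.Z x‖ := by linarith
  have hw : D.w x ≤ (1 + Real.pi + 1 / s) * ‖D.Z x‖ ^ s := by
    have e1 : ‖D.t x‖ ≤ Real.log ‖D.Z x‖ + Real.pi := by
      refine (Complex.norm_le_abs_re_add_abs_im _).trans ?_
      rw [t, Complex.log_re, Complex.log_im, abs_of_nonneg (Real.log_nonneg hZ1)]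
      gcongr
      exact Complex.abs_arg_le_pi _
    have e2 := Real.log_le_rpow_div hZ0.le hs0
    have e3 : 1 ≤ ‖D.Z x‖ ^ s := Real.one_le_rpow hZ1 hs0.le
    rw [w]
    have e4 : (1 + Real.pi + 1 / s) * ‖D.Z x‖ ^ s
        = (1 + Real.pi) * ‖D.Z x‖ ^ s + ‖D.Z x‖ ^ s / s := by ring
    rw [e4]
    nlinarith
  have hw1 := D.one_le_w x
  have hwK : D.w x ^ K ≤ (1 + Real.pi + 1 / s) ^ (K + 1) * ‖D.Z x‖ ^ σ := by
    calc D.w x ^ K ≤ D.w x ^ (K + 1) := pow_le_pow_right₀ hw1 (Nat.le_succ K)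
      _ ≤ ((1 + Real.pi + 1 / s) * ‖D.Z x‖ ^ s) ^ (K + 1) := by gcongr
      _ = _ := by
        rw [mul_pow, ← Real.rpow_mul_natCast hZ0.le]
        congr 2
        rw [hs]
        push_cast
        field_simp
  have hxN : ‖x‖ ^ N ≤ ‖D.Z x‖ ^ (-(D.q * N)) := by
    rw [← neg_mul, Real.rpow_mul_natCast hZ0.le]
    gcongr
    exact (D.norm_lt_of_mem_U (by linarith) hx).le
  rw [Real.norm_of_nonneg (by positivity)] at h1
  refine h1.trans ?_
  rw [Real.rpow_add hZ0]
  calc c * (‖x‖ ^ N * D.w x ^ K) ≤ c * (‖D.Z x‖ ^ (-(D.q * N)) *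
        ((1 + Real.pi + 1 / s) ^ (K + 1) * ‖D.Z x‖ ^ σ)) := by gcongr
    _ = _ := by ring

/-- A holomorphic solution of the Abel equation on `U`, asymptotic to `Z`. -/
theorem exists_abel : ∃ R₁ ≥ (1 : ℝ), D.Tame D.κ₀ R₁ ∧ ∃ b : (Fin n → ℂ) → ℂ,
    DifferentiableOn ℂ b (D.U D.κ₀ R₁) ∧ (∀ x ∈ D.U D.κ₀ R₁, b (D.f x) = b x + 1) ∧
    ∃ C ≥ (0 : ℝ), ∃ δ > (0 : ℝ), δ < 1 ∧
      ∀ x ∈ D.U D.κ₀ R₁, ‖b x - D.Z x‖ ≤ C * ‖D.Z x‖ ^ (1 - δ) := by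
  have hq := D.q_pos
  -- With q N ≥ 2 and a loss of 1/2 for the logarithms, the error is O(|Z|^(-3/2)), which is
  -- summable along orbits.
  obtain ⟨N, hN⟩ := exists_nat_ge (2 / D.q)
  rw [div_le_iff₀ hq] at hN
  obtain ⟨u, hu, hg⟩ := D.exists_h_add_Dz_mem_Err N
  obtain ⟨C₁, hC₁, R₁, hR₁, hb₁⟩ := D.exists_norm_le_of_mem_Err hg (one_half_pos (α := ℝ))
  obtain ⟨C₂, hC₂, R₂, hR₂, hb₂⟩ := D.exists_norm_le_of_mem_Err (D.Pol_le_Err hu) (half_pos hq)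
  obtain ⟨R₃, hR₃, hT⟩ := D.exists_tame D.κ₀_pos le_rfl
  set R := max R₁ (max R₂ R₃) with hR
  have hR1 : R₁ ≤ R := le_max_left _ _
  have hR2 : R₂ ≤ R := (le_max_left _ _).trans (le_max_right _ _)
  have hTR := hT R ((le_max_right _ _).trans (le_max_right _ _))
  have hI := hTR.toInv
  set g := D.h + D.Dz u with hgdef
  have hgb : ∀ y ∈ D.U D.κ₀ R, ‖g y‖ ≤ C₁ * ‖D.Z y‖ ^ (-1 - (1 / 2 : ℝ)) := fun y hy => by
    refine (hb₁ R hR1 y hy).trans ?_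
    have : 1 ≤ ‖D.Z y‖ := hI.one_le.trans hy.2.1.le
    gcongr
    linarith
  have hud := D.differentiableOn_of_mem_Pol (R := R) D.κ₀_pos hu
  have hZd : DifferentiableOn ℂ D.Z (D.U D.κ₀ R) := fun x hx =>
    (D.differentiableAt_Z D.κ₀_pos hx).differentiableWithinAt
  have hfd := hI.differentiableOn_f
  have hgd : DifferentiableOn ℂ g (D.U D.κ₀ R) := by
    refine DifferentiableOn.add (fun x hx => (hI.near x hx).diff_h.differentiableWithinAt) ?_
    exact ((hZd.comp hfd hI.mapsTo).mul (hud.comp hfd hI.mapsTo)).sub (hZd.mul hud)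
  -- In the solution Z + Z u + Σ_j g ∘ f^j, the increment of Z + Z u is 1 + g, and that of the sum
  -- is -g. The exponent δ reflects Z u = O(|Z|^(1 - q/2)); the cap 1/2 only ensures δ < 1.
  refine ⟨R, hI.one_le, hTR, fun x => D.Z x + D.Z x * u x + D.orbitSum g x, ?_, ?_,
    C₂ + C₁ * orbitConst (1 / 2) R, ?_, min (D.q / 2) (1 / 2), by positivity, ?_, ?_⟩
  · exact (hZd.add (hZd.mul hud)).add
      (differentiableOn_orbitSum hI one_half_pos hC₁ hgb hgd)
  · intro x hx
    have e1 := orbitSum_eq_add hI one_half_pos hC₁ hgb hx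
    have e2 := (hI.near x hx).Z_f_add _ (D.p_ne_zero_of_mem_U D.κ₀_pos hx)
    have e3 : g x = D.h x + (D.Z (D.f x) * u (D.f x) - D.Z x * u x) := rfl
    simp only
    rw [e1, e3]
    linear_combination e2
  · have : 0 ≤ orbitConst (1 / 2) R := by
      have := hI.one_le
      unfold orbitConst
      exact mul_nonneg (by positivity) (tsum_nonneg fun j => by positivity)
    positivity
  · exact (min_le_right _ _).trans_lt (by norm_num)
  · intro x hx
    have hZ1 : 1 ≤ ‖D.Z x‖ := hI.one_le.trans hx.2.1.le
    have hZ0 : 0 < ‖D.Z x‖ := by linarith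
    have e1 : ‖D.Z x * u x‖ ≤ C₂ * ‖D.Z x‖ ^ (1 - min (D.q / 2) (1 / 2)) := by
      rw [norm_mul]
      calc ‖D.Z x‖ * ‖u x‖ ≤ ‖D.Z x‖ ^ (1 : ℝ) * (C₂ * ‖D.Z x‖ ^ (-(D.q * (1 : ℕ)) + D.q / 2)) := by
            rw [Real.rpow_one]
            gcongr
            exact hb₂ R hR2 x hx
        _ = C₂ * ‖D.Z x‖ ^ (1 - D.q / 2) := by
            rw [mul_left_comm, ← Real.rpow_add hZ0]
            congr 2
            push_cast
            ring
        _ ≤ _ := by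
            gcongr
            exact min_le_left _ _
    have e2 := norm_orbitSum_le hI one_half_pos hC₁ hgb hx
    have e3 : 1 ≤ ‖D.Z x‖ ^ (1 - min (D.q / 2) (1 / 2)) :=
      Real.one_le_rpow hZ1 (by linarith [min_le_right (D.q / 2) (1 / 2)])
    have e4 : C₁ * orbitConst (1 / 2) R
        ≤ C₁ * orbitConst (1 / 2) R * ‖D.Z x‖ ^ (1 - min (D.q / 2) (1 / 2)) :=
      le_mul_of_one_le_right ((norm_nonneg _).trans e2) e3
    have e5 : D.Z x + D.Z x * u x + D.orbitSum g x - D.Z x = D.Z x * u x + D.orbitSum g x := by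
      ring
    rw [e5, add_mul]
    exact (norm_add_le _ _).trans (add_le_add e1 (e2.trans e4))

end Setup

end FatouCoord

end

/-! ### The Fatou coordinate on V -/

noncomputable section

namespace FatouCoord

open Filter Topology Metric

theorem shift_eq {n : ℕ} [NeZero n] (c : ℂ) (y : Fin n → ℂ) :
    shift c y = y + Pi.single 0 c := by
  funext j
  by_cases h : j = 0
  · subst h
    simp [shift]
  · simp [shift, h]

theorem add_single_apply_of_ne {n : ℕ} [NeZero n] (y : Fin n → ℂ) (s : ℂ) {j : Fin n}
    (hj : j ≠ 0) : (y + Pi.single 0 s : Fin n → ℂ) j = y j := by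
  simp [hj]

theorem mem_modelSpace_congr {n : ℕ} [NeZero n] {M : Fin n → ℕ} {y y' : Fin n → ℂ}
    (h : ∀ j, j ≠ 0 → y' j = y j) (hy : y ∈ modelSpace M) : y' ∈ modelSpace M := by
  intro j hj hj'
  have : j ≠ 0 := fun h0 => by simp [h0] at hj
  rw [h j this]
  exact hy j hj hj'

theorem add_mem_sector_of_norm_le {κ κ' : ℝ} (hκ : 0 < κ) (hκ' : κ < κ') (h1 : κ' ≤ 1) {z s : ℂ}
    (hz : z ∈ sector κ) (hs : ‖s‖ ≤ (κ' - κ) / 4 * ‖z‖) : z + s ∈ sector κ' := by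
  have h0 := re_pos_of_mem_sector hκ hz
  have h2 := norm_le_two_mul_re hκ (hκ'.le.trans h1) hz
  have h3 : |z.im| < κ * z.re := hz
  have h4 := (Complex.abs_im_le_norm s).trans hs
  have h5 := (abs_le.1 ((Complex.abs_re_le_norm s).trans hs)).1
  have h6 := abs_add_le z.im s.im
  have h7 : (κ' - κ) / 4 * ‖z‖ ≤ (κ' - κ) / 4 * (2 * z.re) := by
    have : 0 ≤ (κ' - κ) / 4 := by linarith
    gcongr
  change |(z + s).im| < κ' * (z + s).re
  rw [Complex.add_im, Complex.add_re]
  have h8 : κ' * (z.re - (κ' - κ) / 4 * (2 * z.re)) ≤ κ' * (z.re + s.re) :=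
    mul_le_mul_of_nonneg_left (by linarith) (by linarith)
  have h9 : κ' * ((κ' - κ) / 4 * (2 * z.re)) ≤ 1 * ((κ' - κ) / 4 * (2 * z.re)) := by
    have : 0 ≤ (κ' - κ) / 4 * (2 * z.re) := mul_nonneg (by linarith) (by linarith)
    gcongr
  linarith

namespace Setup

variable {n : ℕ} [NeZero n] (D : Setup n)

theorem prod_congr_of_eq {y y' : Fin n → ℂ} (h : ∀ j, j ≠ 0 → y' j = y j) (i : Fin n) :
    ∏ j ∈ Finset.univ.erase 0, y' j ^ invZ D.P i j
      = ∏ j ∈ Finset.univ.erase 0, y j ^ invZ D.P i j :=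
  Finset.prod_congr rfl fun j hj => by rw [h j (Finset.ne_of_mem_erase hj)]

theorem exponent_pos (i : Fin n) : 0 < -D.q - (D.a i).re := by
  have := D.haγ i
  rw [q]
  linarith

/-- A bound on `r` that leaves room for halving `|z|`. -/
def r₂ : ℝ := D.r₁ * 2 ^ (-∑ i, (-D.q - (D.a i).re))

theorem r₂_pos : 0 < D.r₂ := mul_pos D.r₁_pos (by positivity)

theorem r₂_le (i : Fin n) : D.r₂ ≤ D.r₁ * 2 ^ (-(-D.q - (D.a i).re)) := by
  have h1 : -D.q - (D.a i).re ≤ ∑ i, (-D.q - (D.a i).re) :=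
    Finset.single_le_sum (f := fun i => -D.q - (D.a i).re)
      (fun i _ => (D.exponent_pos i).le) (Finset.mem_univ i)
  have := D.r₁_pos
  unfold r₂
  gcongr
  norm_num

theorem r₂_le_r₁ : D.r₂ ≤ D.r₁ := by
  refine (D.r₂_le 0).trans (mul_le_of_le_one_right D.r₁_pos.le ?_)
  exact Real.rpow_le_one_of_one_le_of_nonpos one_le_two (by linarith [D.exponent_pos 0])

/-- A solution of the Abel equation on `U`, asymptotic to `Z`. -/
structure Abel (R₁ C δ : ℝ) (b : (Fin n → ℂ) → ℂ) : Prop where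
  tame : D.Tame D.κ₀ R₁
  diff : DifferentiableOn ℂ b (D.U D.κ₀ R₁)
  abel : ∀ x ∈ D.U D.κ₀ R₁, b (D.f x) = b x + 1
  C_nonneg : 0 ≤ C
  δ_pos : 0 < δ
  δ_lt : δ < 1
  bound : ∀ x ∈ D.U D.κ₀ R₁, ‖b x - D.Z x‖ ≤ C * ‖D.Z x‖ ^ (1 - δ)

/-- Smallness conditions on the parameters of the domain `V`. -/
structure Fine (R₁ C δ κ R r : ℝ) : Prop where
  tame : D.Tame κ R
  κ_lt : κ < D.κ₀
  le_R : 2 * R₁ ≤ R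
  r_pos : 0 < r
  r_le : r ≤ D.r₂
  small : 32 * C * R ^ (-δ) ≤ D.κ₀ - κ

/-- The deviation of the Fatou coordinate from `z`. -/
def dev (b : (Fin n → ℂ) → ℂ) (y : Fin n → ℂ) : ℂ := b (D.S y) - y 0

/-- The Fatou coordinates. -/
def fatou (b : (Fin n → ℂ) → ℂ) (y : Fin n → ℂ) : Fin n → ℂ := y + Pi.single 0 (D.dev b y)

theorem fatou_zero (b : (Fin n → ℂ) → ℂ) (y : Fin n → ℂ) : D.fatou b y 0 = b (D.S y) := by
  simp [fatou, dev]

theorem fatou_of_ne (b : (Fin n → ℂ) → ℂ) (y : Fin n → ℂ) {j : Fin n} (hj : j ≠ 0) :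
    D.fatou b y j = y j := add_single_apply_of_ne _ _ hj

/-- The map `F̃`. -/
def F (y : Fin n → ℂ) : Fin n → ℂ := D.Ph (D.f (D.S y))

section Fatou

variable {D} {R₁ C δ κ R r : ℝ} {b : (Fin n → ℂ) → ℂ}

theorem Abel.norm_dev_le (hA : D.Abel R₁ C δ b) {y : Fin n → ℂ} (hy : y ∈ D.V D.κ₀ R₁ D.r₁) :
    ‖D.dev b y‖ ≤ C * ‖y 0‖ ^ (1 - δ) := by
  have := hA.bound _ (S_mem hA.tame D.r₁_pos le_rfl hy)
  rwa [Z_S hA.tame D.r₁_pos le_rfl hy] at this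

theorem Abel.differentiableOn_dev (hA : D.Abel R₁ C δ b) :
    DifferentiableOn ℂ (D.dev b) (D.V D.κ₀ R₁ D.r₁) :=
  (hA.diff.comp (differentiableOn_S hA.tame D.r₁_pos le_rfl)
    fun _ hy => S_mem hA.tame D.r₁_pos le_rfl hy).sub
      (differentiable_apply 0).differentiableOn

theorem Fine.V_subset (hA : D.Abel R₁ C δ b) (hF : D.Fine R₁ C δ κ R r) :
    D.V κ R r ⊆ D.V D.κ₀ R₁ D.r₁ :=
  D.V_mono hF.κ_lt.le hF.tame.κ_pos (by linarith [hF.le_R, hA.tame.one_le])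
    (hF.r_le.trans D.r₂_le_r₁)

/-- V is surrounded, in the z direction, by discs of radius proportional to |z| inside the larger
domain: the sector is wider there, and halving |z| is absorbed by R ≥ 2 R₁ and by r ≤ `r₂`. -/
theorem Fine.add_single_mem (hA : D.Abel R₁ C δ b) (hF : D.Fine R₁ C δ κ R r) {y : Fin n → ℂ}
    (hy : y ∈ D.V κ R r) {s : ℂ} (hs : ‖s‖ ≤ (D.κ₀ - κ) / 4 * ‖y 0‖) :
    y + Pi.single 0 s ∈ D.V D.κ₀ R₁ D.r₁ := by
  have hκ := hF.tame.κ_pos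
  have hκ1 := D.κ₀_le
  have hR1 := hA.tame.one_le
  have hne : ∀ j, j ≠ 0 → (y + Pi.single 0 s : Fin n → ℂ) j = y j := fun j hj =>
    add_single_apply_of_ne y s hj
  have h0 : (y + Pi.single 0 s : Fin n → ℂ) 0 = y 0 + s := by simp
  have hz : 0 < ‖y 0‖ := by linarith [hy.2.2.1, hF.tame.one_le]
  have hc : (D.κ₀ - κ) / 4 ≤ 1 / 2 := by linarith
  have hs2 : ‖s‖ ≤ 1 / 2 * ‖y 0‖ := hs.trans (by gcongr)
  have hhalf : ‖y 0‖ / 2 ≤ ‖y 0 + s‖ := by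
    have := norm_sub_le (y 0 + s) s
    rw [add_sub_cancel_right] at this
    linarith
  refine ⟨mem_modelSpace_congr hne hy.1, ?_, ?_, fun i => ?_⟩
  · rw [h0]
    exact add_mem_sector_of_norm_le hκ hF.κ_lt hκ1 hy.2.1 hs
  · rw [h0]
    linarith [hF.le_R, hy.2.2.1]
  · rw [D.prod_congr_of_eq hne, h0]
    have hr₁ := D.r₁_pos
    have hexp := D.exponent_pos i
    calc _ < r * ‖y 0‖ ^ (-D.q - (D.a i).re) := hy.2.2.2 i
      _ ≤ D.r₁ * 2 ^ (-(-D.q - (D.a i).re)) * ‖y 0‖ ^ (-D.q - (D.a i).re) := by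
        gcongr
        exact hF.r_le.trans (D.r₂_le i)
      _ = D.r₁ * (‖y 0‖ / 2) ^ (-D.q - (D.a i).re) := by
        rw [Real.div_rpow (norm_nonneg _) zero_le_two, Real.rpow_neg zero_le_two]
        ring
      _ ≤ _ := by gcongr

/-- These are the inputs for the Schwarz and Cauchy estimates in z. The last quotient is at most 16
C R^(-δ) / (κ₀ - κ), which explains the 32 in `Fine.small`. -/
theorem Fine.line (hA : D.Abel R₁ C δ b) (hF : D.Fine R₁ C δ κ R r) {y : Fin n → ℂ}
    (hy : y ∈ D.V κ R r) :
    0 < (D.κ₀ - κ) / 4 * ‖y 0‖ ∧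
    DifferentiableOn ℂ (fun s : ℂ => D.dev b (y + Pi.single 0 s))
      (ball 0 ((D.κ₀ - κ) / 4 * ‖y 0‖)) ∧
    (∀ s ∈ ball (0 : ℂ) ((D.κ₀ - κ) / 4 * ‖y 0‖),
      ‖D.dev b (y + Pi.single 0 s)‖ ≤ C * (2 * ‖y 0‖) ^ (1 - δ)) ∧
    2 * (C * (2 * ‖y 0‖) ^ (1 - δ)) / ((D.κ₀ - κ) / 4 * ‖y 0‖) ≤ 1 / 2 := by
  have hκ := hF.tame.κ_pos
  have hκ1 := D.κ₀_le
  have hR := hF.tame.one_le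
  have hC := hA.C_nonneg
  have hδ := hA.δ_lt
  have hδ0 := hA.δ_pos
  have hc : 0 < (D.κ₀ - κ) / 4 := by linarith [hF.κ_lt]
  have hz : 0 < ‖y 0‖ := by linarith [hy.2.2.1]
  have hmem : ∀ s ∈ ball (0 : ℂ) ((D.κ₀ - κ) / 4 * ‖y 0‖),
      y + Pi.single 0 s ∈ D.V D.κ₀ R₁ D.r₁ := fun s hs =>
    hF.add_single_mem hA hy (mem_ball_zero_iff.1 hs).le
  refine ⟨by positivity, ?_, fun s hs => ?_, ?_⟩
  · refine hA.differentiableOn_dev.comp ?_ hmem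
    refine Differentiable.differentiableOn ?_
    exact (differentiable_const y).add
      (ContinuousLinearMap.single ℂ (fun _ : Fin n => ℂ) 0).differentiable
  · refine (hA.norm_dev_le (hmem s hs)).trans ?_
    have : ‖(y + Pi.single 0 s : Fin n → ℂ) 0‖ ≤ 2 * ‖y 0‖ := by
      simp only [Pi.add_apply, Pi.single_eq_same]
      have h1 := mem_ball_zero_iff.1 hs
      have h2 : (D.κ₀ - κ) / 4 * ‖y 0‖ ≤ 1 * ‖y 0‖ := by gcongr; linarith
      linarith [norm_add_le (y 0) s]
    gcongr
  · have h1 : (2 * ‖y 0‖) ^ (1 - δ) ≤ 2 * (‖y 0‖ * R ^ (-δ)) := by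
      rw [Real.mul_rpow zero_le_two hz.le]
      have e1 : (2 : ℝ) ^ (1 - δ) ≤ 2 := by
        calc (2 : ℝ) ^ (1 - δ) ≤ 2 ^ (1 : ℝ) :=
              Real.rpow_le_rpow_of_exponent_le one_le_two (by linarith)
          _ = 2 := Real.rpow_one 2
      have e2 : ‖y 0‖ ^ (1 - δ) ≤ ‖y 0‖ * R ^ (-δ) := by
        have e3 : ‖y 0‖ ^ (-δ) ≤ R ^ (-δ) :=
          Real.rpow_le_rpow_of_nonpos (by linarith) hy.2.2.1.le (by linarith)
        rw [sub_eq_add_neg, Real.rpow_add hz, Real.rpow_one]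
        gcongr
      gcongr
    rw [div_le_iff₀ (by positivity)]
    have h2 := mul_le_mul_of_nonneg_left h1 hC
    have h3 := mul_le_mul_of_nonneg_right hF.small hz.le
    linarith

theorem Fine.dev_sub_le_of_near (hA : D.Abel R₁ C δ b) (hF : D.Fine R₁ C δ κ R r)
    {y : Fin n → ℂ} (hy : y ∈ D.V κ R r) {s : ℂ} (hs : ‖s‖ < (D.κ₀ - κ) / 4 * ‖y 0‖) :
    ‖D.dev b (y + Pi.single 0 s) - D.dev b y‖ ≤ 1 / 2 * ‖s‖ := by
  obtain ⟨-, h2, h3, h4⟩ := hF.line hA hy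
  have := dist_le_of_bound h2 h3 (mem_ball_zero_iff.2 hs)
  simp only [Pi.single_zero, add_zero, sub_zero] at this
  exact this.trans (by gcongr)

theorem eq_add_single {y y' : Fin n → ℂ} (h : ∀ j, j ≠ 0 → y' j = y j) :
    y' = y + Pi.single 0 (y' 0 - y 0) := by
  funext j
  by_cases hj : j = 0
  · subst hj
    simp
  · simp [hj, h j hj]

/-- The deviation of the Fatou coordinate from `z` is a contraction in `z`. -/
theorem Fine.dev_sub_le (hA : D.Abel R₁ C δ b) (hF : D.Fine R₁ C δ κ R r)
    {y y' : Fin n → ℂ} (hy : y ∈ D.V κ R r) (hy' : y' ∈ D.V κ R r)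
    (h : ∀ j, j ≠ 0 → y' j = y j) : ‖D.dev b y' - D.dev b y‖ ≤ 1 / 2 * ‖y' 0 - y 0‖ := by
  by_cases h1 : ‖y' 0 - y 0‖ < (D.κ₀ - κ) / 4 * ‖y 0‖
  · have := hF.dev_sub_le_of_near hA hy h1
    rwa [← eq_add_single h] at this
  by_cases h2 : ‖y 0 - y' 0‖ < (D.κ₀ - κ) / 4 * ‖y' 0‖
  · have := hF.dev_sub_le_of_near hA hy' h2
    rw [← eq_add_single fun j hj => (h j hj).symm] at this
    rwa [norm_sub_rev, norm_sub_rev (y' 0)]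
  rw [norm_sub_rev (y 0)] at h2
  push Not at h1 h2
  have hC := hA.C_nonneg
  have hR := hF.tame.one_le
  -- The slices of V in z are not treated as convex, so points far apart are compared by size. Each
  -- deviation is at most (κ₀ - κ) / 32 times |z|, hence at most 1/8 of the distance.
  have key : ∀ v ∈ D.V κ R r, ‖D.dev b v‖ ≤ (D.κ₀ - κ) / 32 * ‖v 0‖ := fun v hv => by
    refine (hA.norm_dev_le (hF.V_subset hA hv)).trans ?_
    have hz : 0 < ‖v 0‖ := by linarith [hv.2.2.1]
    have hδ0 := hA.δ_pos
    rw [sub_eq_add_neg, Real.rpow_add hz, Real.rpow_one]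
    have e1 : ‖v 0‖ ^ (-δ) ≤ R ^ (-δ) :=
      Real.rpow_le_rpow_of_nonpos (by linarith) hv.2.2.1.le (by linarith)
    have e2 := mul_le_mul_of_nonneg_left e1 hC
    have e3 : C * ‖v 0‖ ^ (-δ) ≤ (D.κ₀ - κ) / 32 := by linarith [hF.small]
    calc C * (‖v 0‖ * ‖v 0‖ ^ (-δ)) = C * ‖v 0‖ ^ (-δ) * ‖v 0‖ := by ring
      _ ≤ _ := by gcongr
  have := norm_sub_le (D.dev b y') (D.dev b y)
  linarith [key y hy, key y' hy', norm_nonneg (y' 0 - y 0)]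

theorem Fine.injOn_fatou (hA : D.Abel R₁ C δ b) (hF : D.Fine R₁ C δ κ R r) :
    Set.InjOn (D.fatou b) (D.V κ R r) := by
  intro y hy y' hy' heq
  have h : ∀ j, j ≠ 0 → y' j = y j := fun j hj => by
    rw [← D.fatou_of_ne b y hj, heq, D.fatou_of_ne b y' hj]
  have h1 := hF.dev_sub_le hA hy hy' h
  have h2 : D.dev b y' - D.dev b y = -(y' 0 - y 0) := by
    have := congrFun heq 0
    simp only [fatou, Pi.add_apply, Pi.single_eq_same] at this
    linear_combination -this
  rw [h2, norm_neg] at h1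
  have h3 : ‖y' 0 - y 0‖ = 0 := le_antisymm (by linarith) (norm_nonneg _)
  have := eq_add_single h
  rw [norm_eq_zero.1 h3, Pi.single_zero, add_zero] at this
  exact this.symm

/-- The derivative is the identity plus a rank-one map into the z axis, and |∂ dev / ∂z| ≤ 1/2
excludes a kernel. -/
theorem Fine.exists_equiv (hA : D.Abel R₁ C δ b) (hF : D.Fine R₁ C δ κ R r) {y : Fin n → ℂ}
    (hy : y ∈ D.V κ R r) : ∃ L : (Fin n → ℂ) ≃L[ℂ] (Fin n → ℂ),
      HasStrictFDerivAt (D.fatou b) (L : (Fin n → ℂ) →L[ℂ] (Fin n → ℂ)) y := by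
  have hV : IsOpen (D.V D.κ₀ R₁ D.r₁) := D.isOpen_V (by linarith [hA.tame.one_le])
  have hyV := hF.V_subset hA hy
  set E := fderiv ℂ (D.dev b) y with hE
  have hE' : HasStrictFDerivAt (D.dev b) E y :=
    hasStrictFDerivAt_of_differentiableOn hV hA.differentiableOn_dev hyV
  set ι := ContinuousLinearMap.single ℂ (fun _ : Fin n => ℂ) 0 with hι
  set L := ContinuousLinearMap.id ℂ (Fin n → ℂ) + ι.comp E with hL
  have hB : HasStrictFDerivAt (D.fatou b) L y :=
    (hasStrictFDerivAt_id y).add (ι.hasStrictFDerivAt.comp y hE')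
  have hsmall : ‖E (Pi.single 0 1)‖ ≤ 1 / 2 := by
    obtain ⟨h1, h2, h3, h4⟩ := hF.line hA hy
    have h5 := (norm_fderiv_le_of_bound h1 h2 h3).trans h4
    have h6 : HasFDerivAt (fun s : ℂ => D.dev b (y + Pi.single 0 s)) (E.comp ι) 0 := by
      have h7 : HasFDerivAt (fun s : ℂ => y + Pi.single 0 s) ι 0 := ι.hasFDerivAt.const_add y
      refine HasFDerivAt.comp (g := D.dev b) 0 ?_ h7
      simpa using hE'.hasFDerivAt
    rw [h6.fderiv] at h5
    have h8 := (E.comp ι).le_of_opNorm_le h5 1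
    simpa [hι] using h8
  have hinj : Function.Injective (L : (Fin n → ℂ) →ₗ[ℂ] (Fin n → ℂ)) := by
    rw [← LinearMap.ker_eq_bot, LinearMap.ker_eq_bot']
    intro v hv
    have hv' : v + Pi.single 0 (E v) = 0 := hv
    have hvs : v = Pi.single 0 (v 0) := by
      funext j
      by_cases hj : j = 0
      · subst hj
        simp
      · have := congrFun hv' j
        simpa [hj] using this
    have h0 : v 0 + v 0 * E (Pi.single 0 1) = 0 := by
      have h1 := congrFun hv' 0
      have h2 : v = v 0 • (Pi.single 0 1 : Fin n → ℂ) := by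
        rw [← Pi.single_smul, smul_eq_mul, mul_one]
        exact hvs
      have h3 : E v = v 0 * E (Pi.single 0 1) := by
        conv_lhs => rw [h2]
        rw [map_smul, smul_eq_mul]
      rw [h3] at h1
      simpa using h1
    have h1 : 1 + E (Pi.single 0 1) ≠ 0 := fun h => by
      have := norm_neg (E (Pi.single 0 1))
      rw [← eq_neg_of_add_eq_zero_left h, norm_one] at this
      linarith
    have h2 : v 0 = 0 := by
      have : v 0 * (1 + E (Pi.single 0 1)) = 0 := by linear_combination h0
      exact (mul_eq_zero.1 this).resolve_right h1
    rw [hvs, h2, Pi.single_zero]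
  refine ⟨(LinearEquiv.ofInjectiveEndo _ hinj).toContinuousLinearEquiv, ?_⟩
  exact hB.congr_fderiv (ContinuousLinearMap.ext fun v => rfl)

/-- The map is injective and locally invertible, so its image is open and the global inverse agrees
with the local ones. -/
theorem Fine.isBiholomorphism (hA : D.Abel R₁ C δ b) (hF : D.Fine R₁ C δ κ R r) :
    IsBiholomorphism (D.fatou b) (D.V κ R r) (D.fatou b '' D.V κ R r) := by
  have hV : IsOpen (D.V κ R r) := D.isOpen_V (by linarith [hF.tame.one_le])
  have hinj := hF.injOn_fatou hA
  have hleft := hinj.leftInvOn_invFunOn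
  refine ⟨hV, ?_, fun y hy => ?_, Set.mapsTo_image _ _, Function.invFunOn (D.fatou b) (D.V κ R r),
    ?_, ?_, hleft, ?_⟩
  · rw [isOpen_iff_mem_nhds]
    rintro _ ⟨y, hy, rfl⟩
    obtain ⟨L, hL⟩ := hF.exists_equiv hA hy
    rw [← hL.map_nhds_eq_of_equiv]
    exact image_mem_map (hV.mem_nhds hy)
  · obtain ⟨L, hL⟩ := hF.exists_equiv hA hy
    exact hL.hasFDerivAt.differentiableAt.differentiableWithinAt
  · rintro _ ⟨y, hy, rfl⟩
    obtain ⟨L, hL⟩ := hF.exists_equiv hA hy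
    have : ∀ᶠ x in 𝓝 y, Function.invFunOn (D.fatou b) (D.V κ R r) (D.fatou b x) = x := by
      filter_upwards [hV.mem_nhds hy] with x hx using hleft hx
    exact (hL.to_local_left_inverse this).hasFDerivAt.differentiableAt.differentiableWithinAt
  · rintro _ ⟨y, hy, rfl⟩
    rw [hleft hy]
    exact hy
  · rintro _ ⟨y, hy, rfl⟩
    rw [hleft hy]

theorem F_zero (y : Fin n → ℂ) : D.F y 0 = D.Z (D.f (D.S y)) := by
  rw [F, Ph, Phi, if_pos rfl, Z, p, one_div]

theorem F_of_ne (hT : D.Tame κ R) (hr : 0 < r) (hr₁ : r ≤ D.r₁) {y : Fin n → ℂ}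
    (hy : y ∈ D.V κ R r) {j : Fin n} (hj : j ≠ 0) : D.F y j = y j := by
  have hS := S_mem hT hr hr₁ hy
  have h1 := congrFun (Ph_S hT hr hr₁ hy) j
  rw [Ph, Phi, if_neg hj, hT.psi_eq hS] at h1
  rw [F, Ph, Phi, if_neg hj, hT.psi_eq (hT.mapsTo hS), hT.psiLim_f hS, h1]

/-- |z| does not decrease under F̃ and w is fixed. As -q - Re a_i > 0, the bounds on the monomials
in w only relax. -/
theorem mapsTo_F (hT : D.Tame κ R) (hr : 0 < r) (hr₁ : r ≤ D.r₁) :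
    Set.MapsTo D.F (D.V κ R r) (D.V κ R r) := by
  intro y hy
  have hS := S_mem hT hr hr₁ hy
  have hfS := hT.mapsTo hS
  have h0 := F_zero (D := D) y
  have hne : ∀ j, j ≠ 0 → D.F y j = y j := fun j hj => F_of_ne hT hr hr₁ hy hj
  refine ⟨mem_modelSpace_congr hne hy.1, by rw [h0]; exact hfS.1, by rw [h0]; exact hfS.2.1,
    fun i => ?_⟩
  rw [D.prod_congr_of_eq hne, h0]
  have h1 := hT.norm_le _ hS
  rw [Z_S hT hr hr₁ hy] at h1
  have h2 := D.exponent_pos i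
  exact (hy.2.2.2 i).trans_le (by gcongr)

/-- f(S y) lies in U and is sent to F y by Φ_ℓ, so uniqueness of preimages identifies it. -/
theorem S_F (hT : D.Tame κ R) (hr : 0 < r) (hr₁ : r ≤ D.r₁) {y : Fin n → ℂ}
    (hy : y ∈ D.V κ R r) : D.S (D.F y) = D.f (D.S y) :=
  (eq_S_of_Ph_eq hT hr hr₁ (mapsTo_F hT hr hr₁ hy) (hT.mapsTo (S_mem hT hr hr₁ hy)) rfl).symm

theorem Fine.fatou_F (hA : D.Abel R₁ C δ b) (hF : D.Fine R₁ C δ κ R r) {y : Fin n → ℂ}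
    (hy : y ∈ D.V κ R r) : D.fatou b (D.F y) = shift 1 (D.fatou b y) := by
  have hr₁ := hF.r_le.trans D.r₂_le_r₁
  rw [shift_eq]
  funext j
  by_cases hj : j = 0
  · subst hj
    rw [fatou_zero, S_F hF.tame hF.r_pos hr₁ hy,
      hA.abel _ (S_mem hA.tame D.r₁_pos le_rfl (hF.V_subset hA hy)), Pi.add_apply,
      Pi.single_eq_same, fatou_zero]
  · rw [D.fatou_of_ne b _ hj, F_of_ne hF.tame hF.r_pos hr₁ hy hj,
      add_single_apply_of_ne _ _ hj, D.fatou_of_ne b _ hj]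

/-- For large j the points (y_0 + j + s, w) with |s| ≤ κ j / 4 all lie in V: w is fixed while r
|z|^(-q - Re a_i) tends to infinity. The equation for the Fatou coordinate becomes s = -dev, and
-dev is a contraction of this disc because dev = O(|z|^(1-δ)). -/
theorem Fine.exists_fatou_eq (hA : D.Abel R₁ C δ b) (hF : D.Fine R₁ C δ κ R r) {y : Fin n → ℂ}
    (hy : y ∈ modelSpace D.M) :
    ∃ j : ℕ, ∃ v ∈ D.V κ R r, D.fatou b v = y + Pi.single 0 (j : ℂ) := by
  have hκ := hF.tame.κ_pos
  have hκ1 : κ ≤ 1 := hF.κ_lt.le.trans D.κ₀_le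
  have hC := hA.C_nonneg
  have hδ := hA.δ_pos
  have hδ1 := hA.δ_lt
  have hr := hF.r_pos
  have hhalf : Tendsto (fun T : ℝ => T / 2) atTop atTop := tendsto_id.atTop_div_const two_pos
  have e1 : ∀ᶠ T : ℝ in atTop, ∀ i, ‖∏ j ∈ Finset.univ.erase 0, y j ^ invZ D.P i j‖ / r
      < (T / 2) ^ (-D.q - (D.a i).re) := eventually_all.2 fun i =>
    ((tendsto_rpow_atTop (D.exponent_pos i)).comp hhalf).eventually_gt_atTop _
  -- On the disc T / 2 ≤ |z| ≤ 2 T, so |dev| ≤ 2 C T (T / 2)^(-δ). The constant 8 brings this below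
  -- the radius κ T / 4.
  have e2 : ∀ᶠ T : ℝ in atTop, 8 * C * (T / 2) ^ (-δ) < κ := by
    have := (((tendsto_rpow_neg_atTop hδ).comp hhalf).const_mul (8 * C))
    rw [mul_zero] at this
    exact this.eventually_lt_const hκ
  have e3 := eventually_gt_atTop (max (2 * R) (8 / κ * ‖y 0‖))
  obtain ⟨j, h1, h2, h3⟩ := (tendsto_natCast_atTop_atTop.eventually (e1.and (e2.and e3))).exists
  set T : ℝ := (j : ℝ) with hT
  have hTR : 2 * R < T := (le_max_left _ _).trans_lt h3
  have hTζ : 8 * ‖y 0‖ < κ * T := by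
    have := (le_max_right (2 * R) (8 / κ * ‖y 0‖)).trans_lt h3
    rw [div_mul_eq_mul_div, div_lt_iff₀ hκ] at this
    linarith
  have hT0 : 0 < T := by linarith [hF.tame.one_le]
  have hκT : κ * T ≤ T := mul_le_of_le_one_left hT0.le hκ1
  have hjn : ‖(j : ℂ)‖ = T := by simp [hT]
  set c : ℂ → (Fin n → ℂ) := fun s => y + Pi.single 0 (j + s) with hc
  have hc0 : ∀ s, c s 0 = y 0 + (j + s) := fun s => by simp [hc]
  have hcne : ∀ s k, k ≠ 0 → c s k = y k := fun s k hk => add_single_apply_of_ne _ _ hk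
  have hsec : (j : ℂ) ∈ sector (κ / 4) := by
    change |(j : ℂ).im| < κ / 4 * (j : ℂ).re
    rw [Complex.natCast_im, Complex.natCast_re, abs_zero]
    positivity
  have hlow : ∀ s : ℂ, ‖s‖ ≤ κ / 4 * T → T / 2 ≤ ‖c s 0‖ ∧ ‖c s 0‖ ≤ 2 * T := fun s hs => by
    have g1 := norm_add_le (y 0) ((j : ℂ) + s)
    have g2 := norm_add_le (j : ℂ) s
    have g3 := norm_sub_le (y 0 + ((j : ℂ) + s)) (y 0 + s)
    have g4 := norm_add_le (y 0) s
    have g5 : y 0 + ((j : ℂ) + s) - (y 0 + s) = j := by ring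
    rw [g5] at g3
    rw [hc0]
    constructor <;> linarith
  have hmem : ∀ s : ℂ, ‖s‖ ≤ κ / 4 * T → c s ∈ D.V κ R r := fun s hs => by
    obtain ⟨g1, g2⟩ := hlow s hs
    refine ⟨mem_modelSpace_congr (hcne s) hy, ?_, by linarith, fun i => ?_⟩
    · rw [hc0]
      have g3 : ‖y 0 + s‖ ≤ (κ / 4 + κ / 8) * T := by linarith [norm_add_le (y 0) s]
      have g4 := (Complex.abs_im_le_norm (y 0 + s)).trans g3
      have g5 := (abs_le.1 ((Complex.abs_re_le_norm (y 0 + s)).trans g3)).1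
      change |(y 0 + (j + s)).im| < κ * (y 0 + (j + s)).re
      have g6 : y 0 + ((j : ℂ) + s) = j + (y 0 + s) := by ring
      rw [g6, Complex.add_im ((j : ℂ)), Complex.add_re ((j : ℂ)), Complex.natCast_im,
        Complex.natCast_re, zero_add]
      have g7 : κ * (T - (κ / 4 + κ / 8) * T) ≤ κ * (T + (y 0 + s).re) :=
        mul_le_mul_of_nonneg_left (by linarith) hκ.le
      have g8 : κ * (κ * T) ≤ κ * T := mul_le_mul_of_nonneg_left hκT hκ.le
      have g9 : 0 < κ * T := by positivity
      linarith
    · rw [D.prod_congr_of_eq (hcne s)]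
      have g3 := (div_lt_iff₀' hr).1 (h1 i)
      have g4 := D.exponent_pos i
      exact g3.trans_le (by gcongr)
  have hmaps : Set.MapsTo (fun s => -D.dev b (c s)) (closedBall (0 : ℂ) (κ / 4 * T))
      (closedBall 0 (κ / 4 * T)) := fun s hs => by
    rw [mem_closedBall_zero_iff] at hs ⊢
    obtain ⟨g1, g2⟩ := hlow s hs
    rw [norm_neg]
    refine (hA.norm_dev_le (hF.V_subset hA (hmem s hs))).trans ?_
    have hz : 0 < ‖c s 0‖ := by linarith
    rw [sub_eq_add_neg, Real.rpow_add hz, Real.rpow_one]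
    have g3 : ‖c s 0‖ ^ (-δ) ≤ (T / 2) ^ (-δ) :=
      Real.rpow_le_rpow_of_nonpos (by linarith) g1 (by linarith)
    calc C * (‖c s 0‖ * ‖c s 0‖ ^ (-δ)) ≤ C * (2 * T * (T / 2) ^ (-δ)) := by gcongr
      _ = 8 * C * (T / 2) ^ (-δ) * (T / 4) := by ring
      _ ≤ κ * (T / 4) := by gcongr
      _ = _ := by ring
  obtain ⟨s, hs, hfix⟩ := exists_fixedPoint_of_contraction isClosed_closedBall
    ⟨0, mem_closedBall_self (by positivity)⟩ hmaps fun s hs s' hs' => by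
      rw [mem_closedBall_zero_iff] at hs hs'
      have := hF.dev_sub_le hA (hmem s hs) (hmem s' hs') fun k hk => by
        rw [hcne s k hk, hcne s' k hk]
      rw [hc0, hc0] at this
      have g1 : y 0 + ((j : ℂ) + s') - (y 0 + (j + s)) = -(s - s') := by ring
      have g2 : -D.dev b (c s) - -D.dev b (c s') = D.dev b (c s') - D.dev b (c s) := by ring
      rw [g1, norm_neg] at this
      rw [g2]
      exact this
  refine ⟨j, c s, hmem s (mem_closedBall_zero_iff.1 hs), ?_⟩
  have h4 : D.dev b (c s) = -s := by
    rw [← hfix, neg_neg]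
    exact congrArg _ (congrArg c hfix)
  rw [fatou, h4, hc]
  simp only
  rw [add_assoc, ← Pi.single_add, add_neg_cancel_right]

theorem Fine.iUnion_transT (hA : D.Abel R₁ C δ b) (hF : D.Fine R₁ C δ κ R r) :
    ⋃ j : ℕ, transT j '' (D.fatou b '' D.V κ R r) = modelSpace D.M := by
  refine Set.Subset.antisymm (Set.iUnion_subset fun j => ?_) fun y hy => ?_
  · rintro _ ⟨_, ⟨y, hy, rfl⟩, rfl⟩
    refine mem_modelSpace_congr (fun k hk => ?_) hy.1
    rw [transT, shift_eq, add_single_apply_of_ne _ _ hk, D.fatou_of_ne b y hk]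
  · obtain ⟨j, v, hv, h⟩ := hF.exists_fatou_eq hA hy
    refine Set.mem_iUnion.2 ⟨j, _, ⟨v, hv, rfl⟩, ?_⟩
    rw [h, transT, shift_eq, add_assoc, ← Pi.single_add, add_neg_cancel, Pi.single_zero, add_zero]

end Fatou

theorem tildeF_eq {θ ε r : ℝ} (hθ : 0 < θ) (hθ2 : θ < Real.pi / 2) (hε : 0 < ε)
    (hT : D.Tame (Real.tan θ) ε⁻¹) (hr : 0 < r) (hr₁ : r ≤ D.r₁) {y : Fin n → ℂ}
    (hy : y ∈ D.V (Real.tan θ) ε⁻¹ r) : tildeF D.M D.a D.A D.P D.γ ε θ D.ℓ y = D.F y := by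
  rw [tildeF, D.domU_eq hθ hθ2 hε]
  have hex : ∃ x ∈ D.U (Real.tan θ) ε⁻¹, D.Ph x = y :=
    ⟨D.S y, S_mem hT hr hr₁ hy, Ph_S hT hr hr₁ hy⟩
  have := eq_S_of_Ph_eq hT hr hr₁ hy (Function.invFunOn_mem hex) (Function.invFunOn_eq hex)
  change D.Ph (D.f (Function.invFunOn D.Ph (D.U (Real.tan θ) ε⁻¹) y)) = D.F y
  rw [this, F]

end Setup

end FatouCoord

end

/-! ### Choice of the parameters and conclusion -/

theorem proposition5p1 {n : ℕ} [NeZero n]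
    (M : Fin n → ℕ) (a : Fin n → ℂ) (A : Fin n → (Fin n → ℂ) → ℂ)
    -- `f` is the germ with `f_i (x) = x_i (1 + x ^ M (a_i + A_i (x)))`
    (hA : ∀ i, AnalyticAt ℂ (A i) 0) (hA0 : ∀ i, A i 0 = 0)
    -- normalization of the coordinates
    (haM : FatouCoord.pairing a M = -1)
    (hM : ∀ i : Fin n, FatouCoord.redM M i = 0 ↔ n - FatouCoord.mbar M ≤ (i : ℕ))
    -- `Re a_i < 0` for all `i`, and the choice of `γ`
    (ha : ∀ i, (a i).re < 0)
    (γ : ℝ) (hγ : 0 < γ) (haγ : ∀ i, (a i).re + γ / FatouCoord.gcdM M < 0)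
    -- the unimodular block matrix with first row `m`
    (P : Matrix (Fin n) (Fin n) ℕ)
    (hPdet : IsUnit (P.map (fun k : ℕ => (k : ℤ))).det)
    (hProw : P 0 = FatouCoord.redM M)
    (hPblock : ∀ i j : Fin n,
      (n - FatouCoord.mbar M ≤ (i : ℕ) ∨ n - FatouCoord.mbar M ≤ (j : ℕ)) →
        P i j = if i = j then 1 else 0)
    (ℓ : ℕ) (hℓ : ℓ < FatouCoord.gcdM M) :
    -- for all sufficiently small `θ`, `ε` and `r`
    ∃ θ₀ > 0, θ₀ < Real.pi / 2 ∧ ∀ θ : ℝ, 0 < θ → θ < θ₀ →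
    ∃ ε₀ > 0, ∃ r₀ > 0, ∀ ε : ℝ, 0 < ε → ε < ε₀ → ∀ r : ℝ, 0 < r → r < r₀ →
      -- `f` maps `U_ℓ` to itself, and the limits that define `ψ_2, …, ψ_n` exist
      Set.MapsTo (FatouCoord.germMap M a A) (FatouCoord.domU M γ ε θ ℓ)
        (FatouCoord.domU M γ ε θ ℓ) ∧
      (∀ i : Fin n, i ≠ 0 → ∀ x ∈ FatouCoord.domU M γ ε θ ℓ, ∃ c : ℂ,
        Filter.Tendsto
          (fun j : ℕ => FatouCoord.firstIntegral M a ℓ (P i) ((FatouCoord.germMap M a A)^[j] x))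
          Filter.atTop (nhds c)) ∧
      -- every point of `V` has exactly one preimage under `Φ_ℓ` in `U_ℓ`
      (∀ y ∈ FatouCoord.domV M a P γ ε θ r,
        ∃! x, x ∈ FatouCoord.domU M γ ε θ ℓ ∧ FatouCoord.Phi M a A P ℓ x = y) ∧
      -- `F̃` maps `V` to itself and fixes the coordinates `w`
      Set.MapsTo (FatouCoord.tildeF M a A P γ ε θ ℓ) (FatouCoord.domV M a P γ ε θ r)
        (FatouCoord.domV M a P γ ε θ r) ∧
      (∀ y ∈ FatouCoord.domV M a P γ ε θ r, ∀ j : Fin n, j ≠ 0 →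
        FatouCoord.tildeF M a A P γ ε θ ℓ y j = y j) ∧
      -- the Fatou coordinates
      ∃ (W : Set (Fin n → ℂ)) (B : (Fin n → ℂ) → (Fin n → ℂ)),
        FatouCoord.IsBiholomorphism B (FatouCoord.domV M a P γ ε θ r) W ∧
        (∀ y ∈ FatouCoord.domV M a P γ ε θ r,
          B (FatouCoord.tildeF M a A P γ ε θ ℓ y) = FatouCoord.shift 1 (B y)) ∧
        ⋃ j : ℕ, FatouCoord.transT j '' W = FatouCoord.modelSpace M := by
  let D : FatouCoord.Setup n :=
    { M := M, a := a, A := A, hA := hA, hA0 := hA0, haM := haM, γ := γ, hγ := hγ, haγ := haγ,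
      ℓ := ℓ, hM := hM, P := P, hPdet := hPdet, hProw := hProw, hPblock := hPblock }
  obtain ⟨R₁, -, hT₁, b, hbd, hb, C, hC, δ, hδ, hδ1, hbb⟩ := D.exists_abel
  have hAb : D.Abel R₁ C δ b := ⟨hT₁, hbd, hb, hC, hδ, hδ1, hbb⟩
  have hθ₀ := Real.arctan_lt_pi_div_two D.κ₀
  -- The Abel equation is solved once, on the sector of slope κ₀. Every θ < arctan κ₀ leaves room
  -- inside it for the Cauchy estimates, and ε₀ depends on the gap κ₀ - tan θ.
  refine ⟨Real.arctan D.κ₀, Real.arctan_pos.2 D.κ₀_pos, hθ₀, fun θ hθ hθlt => ?_⟩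
  have hθ2 : θ < Real.pi / 2 := hθlt.trans hθ₀
  have hκ : Real.tan θ < D.κ₀ := by
    rw [← Real.tan_arctan D.κ₀]
    exact Real.tan_lt_tan_of_nonneg_of_lt_pi_div_two hθ.le hθ₀ hθlt
  have hκ0 : 0 < Real.tan θ := Real.tan_pos_of_pos_of_lt_pi_div_two hθ hθ2
  obtain ⟨R₂, hR₂, hT⟩ := D.exists_tame hκ0 hκ.le
  have hsmall : ∀ᶠ R : ℝ in Filter.atTop, 32 * C * R ^ (-δ) < D.κ₀ - Real.tan θ := by
    have := (tendsto_rpow_neg_atTop hδ).const_mul (32 * C)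
    rw [mul_zero] at this
    exact this.eventually_lt_const (by linarith)
  obtain ⟨R₃, hR₃⟩ := Filter.eventually_atTop.1 hsmall
  set Rm := max R₂ (max R₃ (2 * R₁)) with hRm
  have hRm0 : 0 < Rm := by linarith [le_max_left R₂ (max R₃ (2 * R₁))]
  refine ⟨Rm⁻¹, inv_pos.2 hRm0, D.r₂, D.r₂_pos, fun ε hε hεlt r hr hrlt => ?_⟩
  have hRε : Rm ≤ ε⁻¹ := by
    rw [← inv_inv Rm]
    exact inv_anti₀ hε hεlt.le
  have hR3 := (le_max_left R₃ (2 * R₁)).trans (le_max_right R₂ _)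
  have hR1 := (le_max_right R₃ (2 * R₁)).trans (le_max_right R₂ _)
  have hTε : D.Tame (Real.tan θ) ε⁻¹ := hT _ ((le_max_left _ _).trans hRε)
  have hF : D.Fine R₁ C δ (Real.tan θ) ε⁻¹ r :=
    ⟨hTε, hκ, hR1.trans hRε, hr, hrlt.le, (hR₃ _ (hR3.trans hRε)).le⟩
  have hr₁ : r ≤ D.r₁ := hrlt.le.trans D.r₂_le_r₁
  have hU : FatouCoord.domU M γ ε θ ℓ = D.U (Real.tan θ) ε⁻¹ := D.domU_eq hθ hθ2 hε
  have hV : FatouCoord.domV M a P γ ε θ r = D.V (Real.tan θ) ε⁻¹ r := D.domV_eq hθ hθ2 hε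
  have htilde : ∀ y ∈ D.V (Real.tan θ) ε⁻¹ r,
      FatouCoord.tildeF M a A P γ ε θ ℓ y = D.F y := fun y hy =>
    D.tildeF_eq hθ hθ2 hε hTε hr hr₁ hy
  rw [hU, hV]
  refine ⟨hTε.mapsTo, fun i _ x hx => ⟨_, hTε.tendsto_firstIntegral hx (P i)⟩, fun y hy => ?_,
    fun y hy => ?_, fun y hy j hj => ?_, D.fatou b '' D.V (Real.tan θ) ε⁻¹ r, D.fatou b,
    hF.isBiholomorphism hAb, fun y hy => ?_, hF.iUnion_transT hAb⟩
  · exact ⟨D.S y, ⟨FatouCoord.Setup.S_mem hTε hr hr₁ hy, FatouCoord.Setup.Ph_S hTε hr hr₁ hy⟩,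
      fun x hx => FatouCoord.Setup.eq_S_of_Ph_eq hTε hr hr₁ hy hx.1 hx.2⟩
  · rw [htilde y hy]
    exact FatouCoord.Setup.mapsTo_F hTε hr hr₁ hy
  · rw [htilde y hy]
    exact FatouCoord.Setup.F_of_ne hTε hr hr₁ hy hj
  · rw [htilde y hy]
    exact hF.fatou_F hAb hy
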